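/- Let $p$ be a prime, $k$ a perfect field of characteristic $p$, $W=W(k)$, $K$ a finite totally ramified extension of $K_0=W[p^{-1}]$ with ring of integers $\mathcal{O}_K$, $\pi$ a uniformizer of $K$, and $E(u)\in W[u]$ the monic minimal polynomial of $\pi$. For a ring $A$ write $A\langle T_1^{\pm1},\dots,T_d^{\pm1}\rangle$ for the $p$-adic completion of $A[T_1^{\pm1},\dots,T_d^{\pm1}]$. A base ring is a ring $R=R_0\otimes_W\mathcal{O}_K$, where $R_0$ is an integral domain obtained from $W\langle T_1^{\pm1},\dots,T_d^{\pm1}\rangle$ (for some $d\ge 0$) by finitely many iterations of the following operations: $p$-adic completion of an étale extension, $p$-adic completion of a localization, completion with respect to an ideal containing $p$. Let $\varphi\colon R_0\to R_0$ be the unique ring endomorphism that lifts the Frobenius $x\mapsto x^p$ of $R_0/pR_0$ and satisfies $\varphi(T_i)=T_i^p$ for all $i$. Extend it to $\mathfrak{S}=R_0[\![u]\!]$ by $\varphi(u)=u^p$, i.e. $\varphi(\sum_n a_nu^n)=\sum_n\varphi(a_n)u^{pn}$. Assume that the base ring $R$ satisfies one of the following two conditions. 1. $R$ is small over $\mathcal{O}_K$: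 for some $d'\ge 0$, $R$ is as an $\mathcal{O}_K$-algebra the $p$-adic completion of an étale algebra over $\mathcal{O}_K\langle T_1^{\pm1},\dots,T_{d'}^{\pm1}\rangle$. 2. $R$ is the ring $\mathcal{O}_L$ of some base ring $A=A_0\otimes_W\mathcal{O}_K$: the ring $R_0$ is $\mathcal{O}_{L_0}$, the $p$-adic completion of the localization of $A_0$ at the prime $(p)$, with the same coordinates $T_i$, and $R=\mathcal{O}_{L_0}\otimes_W\mathcal{O}_K=\mathcal{O}_L$. Let $\mathfrak{M}$ be a finitely generated $\mathfrak{S}$-module with a $\varphi$-semilinear endomorphism $\varphi_{\mathfrak{M}}\colon\mathfrak{M}\to\mathfrak{M}$ of finite $E$-height, i.e. the linearization $$1\otimes\varphi_{\mathfrak{M}}\colon\ \mathfrak{S}\otimes_{\varphi,\mathfrak{S}}\mathfrak{M}\to\mathfrak{M}$$ is injective and its cokernel is killed by $E(u)^r$ for some integer $r\ge 0$. Then $\mathfrak{M}[p^{-1}]$ is a projective $\mathfrak{S}[p^{-1}]$-module. -/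

import Mathlib

open scoped TensorProduct

universe u v

noncomputable section

namespace RelBK

/-- The (classical) `p`-adic completion `lim_n A / p^n A` of a commutative ring `A`. -/
abbrev PCompletion (p : ℕ) (A : Type u) [CommRing A] : Type u :=
  AdicCompletion (Ideal.span {(p : A)}) A

/-- The Laurent polynomial ring `A[T_1^{±1}, …, T_d^{±1}]`, as the localization of
`A[T_1, …, T_d]` at `T_1 ⋯ T_d`. -/
abbrev Laurent (d : ℕ) (A : Type u) [CommRing A] : Type u :=
  Localization.Away (∏ i : Fin d, (MvPolynomial.X i : MvPolynomial (Fin d) A))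

/-- `A⟨T_1^{±1}, …, T_d^{±1}⟩`, the `p`-adic completion of `A[T_1^{±1}, …, T_d^{±1}]`. -/
abbrev CLaurent (p d : ℕ) (A : Type u) [CommRing A] : Type u :=
  PCompletion p (Laurent d A)

/-- The coordinate `T_i` of `A⟨T_1^{±1}, …, T_d^{±1}⟩`. -/
def coordT (p d : ℕ) (A : Type u) [CommRing A] (i : Fin d) : CLaurent p d A :=
  algebraMap (Laurent d A) (CLaurent p d A)
    (algebraMap (MvPolynomial (Fin d) A) (Laurent d A) (MvPolynomial.X i))

/-! ### Small algebras -/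

/-- `R` is small over `A`: for some `d ≥ 0` it is, as an `A`-algebra, the `p`-adic completion of an
étale algebra over `A⟨T_1^{±1}, …, T_d^{±1}⟩`. -/
def IsSmall (p : ℕ) (A : Type u) [CommRing A] (R : Type u) [CommRing R] [Algebra A R] : Prop :=
  ∃ (d : ℕ) (B : Type u) (_ : CommRing B) (_ : Algebra A B) (_ : Algebra (CLaurent p d A) B)
    (_ : IsScalarTower A (CLaurent p d A) B),
    Algebra.Etale (CLaurent p d A) B ∧ Nonempty (R ≃ₐ[A] PCompletion p B)

/-! ### Base rings -/

/-- The `W⟨T_1^{±1}, …, T_d^{±1}⟩`-algebras obtained from `W⟨T_1^{±1}, …, T_d^{±1}⟩` by a finite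
number of iterations of: `p`-adic completion of an étale extension, `p`-adic completion of a
localization, completion with respect to an ideal containing `p`. -/
inductive IsIterated (p d : ℕ) (W : Type u) [CommRing W] :
    ∀ (A : Type u) [CommRing A] [Algebra (CLaurent p d W) A], Prop
  | base : IsIterated p d W (CLaurent p d W)
  | etale (A B : Type u) [CommRing A] [Algebra (CLaurent p d W) A] [CommRing B] [Algebra A B]
      [Algebra (CLaurent p d W) B] [IsScalarTower (CLaurent p d W) A B] [Algebra.Etale A B] :
      IsIterated p d W A → IsIterated p d W (PCompletion p B)
  | localization (A : Type u) [CommRing A] [Algebra (CLaurent p d W) A] (S : Submonoid A) :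
      IsIterated p d W A → IsIterated p d W (PCompletion p (Localization S))
  | completion (A : Type u) [CommRing A] [Algebra (CLaurent p d W) A] (I : Ideal A)
      (hI : (p : A) ∈ I) : IsIterated p d W A → IsIterated p d W (AdicCompletion I A)
  | iso (A B : Type u) [CommRing A] [Algebra (CLaurent p d W) A] [CommRing B]
      [Algebra (CLaurent p d W) B] (e : A ≃ₐ[CLaurent p d W] B) :
      IsIterated p d W A → IsIterated p d W B

/-- The condition on `R₀` for `R = R₀ ⊗_W O_K` to be a base ring: `R₀` is an integral domain
obtained by the operations of `IsIterated`. -/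
structure IsBase (p d : ℕ) (W : Type u) [CommRing W] (R₀ : Type u) [CommRing R₀]
    [Algebra (CLaurent p d W) R₀] : Prop where
  isDomain : IsDomain R₀
  isIterated : IsIterated p d W R₀

/-- The multiplicative set generated by the complement of `(p)`. When `(p)` is a prime ideal (which
is the case for base rings) this is the complement of `(p)`, see `outside_eq_primeCompl`. -/
def outside (p : ℕ) (A : Type u) [CommRing A] : Submonoid A :=
  Submonoid.closure {x | x ∉ Ideal.span {(p : A)}}

theorem outside_eq_primeCompl (p : ℕ) (A : Type u) [CommRing A]
    [h : (Ideal.span {(p : A)}).IsPrime] :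
    outside p A = (Ideal.span {(p : A)}).primeCompl :=
  Submonoid.closure_eq (Ideal.span {(p : A)}).primeCompl

/-- `O_{L₀}`: the `p`-adic completion of the localization of `A₀` at the prime `(p)`. -/
abbrev OL₀ (p : ℕ) (A₀ : Type u) [CommRing A₀] : Type u :=
  PCompletion p (Localization (outside p A₀))

/-- `R₀` is the ring `O_{L₀}` of some base ring `A = A₀ ⊗_W O_K`; equivalently
`R = R₀ ⊗_W O_K` is the ring `O_L` of `A`. -/
def IsOL₀ (p d : ℕ) (W : Type u) [CommRing W] (R₀ : Type u) [CommRing R₀]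
    [Algebra (CLaurent p d W) R₀] : Prop :=
  ∃ (A₀ : Type u) (_ : CommRing A₀) (_ : Algebra (CLaurent p d W) A₀),
    IsBase p d W A₀ ∧ Nonempty (R₀ ≃ₐ[CLaurent p d W] OL₀ p A₀)

/-- `φ` is the Frobenius of `R₀`: the (unique) ring endomorphism that lifts `x ↦ x^p` on `R₀ / p`
and satisfies `φ(T_i) = T_i^p`. -/
structure IsFrobenius (p d : ℕ) (W : Type u) [CommRing W] (R₀ : Type u) [CommRing R₀]
    [Algebra (CLaurent p d W) R₀] (φ : R₀ →+* R₀) : Prop where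
  lift : ∀ x, φ x - x ^ p ∈ Ideal.span {(p : R₀)}
  map_T : ∀ i : Fin d, φ (algebraMap (CLaurent p d W) R₀ (coordT p d W i)) =
    algebraMap (CLaurent p d W) R₀ (coordT p d W i) ^ p

/-! ### The field `K` -/

/-- `O_K`, the integral closure of `W = W(k)` in `K`. -/
abbrev OK (W : Type u) [CommRing W] (K : Type u) [Field K] [Algebra W K] : Type u :=
  integralClosure W K

/-- `K` is totally ramified: the residue field of `O_K` is that of `W`. (`O_K` is local in the case
of interest, so there is only one maximal ideal `P`.) -/
def IsTotRamified (W : Type u) [CommRing W] (K : Type u) [Field K] [Algebra W K] : Prop :=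
  ∀ P : Ideal (OK W K), P.IsMaximal → Function.Surjective (algebraMap W (OK W K ⧸ P))

/-- `π` is a uniformizer: it generates the maximal ideal of `O_K`. -/
def IsUniformizer (W : Type u) [CommRing W] (K : Type u) [Field K] [Algebra W K]
    (π : OK W K) : Prop :=
  (Ideal.span {π}).IsMaximal

/-! ### The ring `𝔖 = R₀⟦u⟧`, its Frobenius, and modules of finite `E`-height -/

/-- The Frobenius of `𝔖 = R₀⟦u⟧`: `∑ a_n u^n ↦ ∑ φ(a_n) u^{pn}`. -/
def frobS (p : ℕ) [hp : Fact p.Prime] {R₀ : Type u} [CommRing R₀] (φ : R₀ →+* R₀) :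
    PowerSeries R₀ →+* PowerSeries R₀ :=
  (PowerSeries.expand (R := R₀) p hp.out.ne_zero).toRingHom.comp (PowerSeries.map φ)

/-- `E(u)`, the minimal polynomial of `π` over `W`, as an element of `R₀⟦u⟧`. -/
def eisE (W : Type u) [CommRing W] (K : Type u) [Field K] [Algebra W K] (π : OK W K)
    (R₀ : Type u) [CommRing R₀] [Algebra W R₀] : PowerSeries R₀ :=
  (((minpoly W π).map (algebraMap W R₀) : Polynomial R₀) : PowerSeries R₀)

/-- The ring `S`, regarded as an `S`-algebra through the endomorphism `f`. -/
def Twist {S : Type u} [CommRing S] (_f : S →+* S) : Type u := S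

instance {S : Type u} [CommRing S] (f : S →+* S) : CommRing (Twist f) :=
  inferInstanceAs (CommRing S)

instance {S : Type u} [CommRing S] (f : S →+* S) : Algebra S (Twist f) :=
  f.toAlgebra

/-- The identity `S → S` seen as a map to `S` with its twisted algebra structure. -/
def Twist.mk {S : Type u} [CommRing S] (f : S →+* S) : S ≃+* Twist f := RingEquiv.refl S

/-- The linearization `1 ⊗ φ_M : S ⊗_{f, S} M → M`, `s ⊗ m ↦ s • φ_M m`, of an `f`-semilinear
endomorphism `φ_M` of `M`. -/
def linearization {S : Type u} [CommRing S] {f : S →+* S} {M : Type v} [AddCommGroup M]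
    [Module S M] (φM : M →ₛₗ[f] M) : Twist f ⊗[S] M →+ M :=
  TensorProduct.liftAddHom
    (AddMonoidHom.mk' (fun s : Twist f =>
      (DistribSMul.toAddMonoidHom M ((Twist.mk f).symm s)).comp φM.toAddMonoidHom)
      (fun a b => by ext m; simp [add_smul]))
    (fun r s m => by
      have h : (Twist.mk f).symm (r • s) = f r * (Twist.mk f).symm s := rfl
      simp [h, mul_smul, smul_comm (f r)])

theorem linearization_tmul {S : Type u} [CommRing S] {f : S →+* S} {M : Type v} [AddCommGroup M]
    [Module S M] (φM : M →ₛₗ[f] M) (s : S) (m : M) :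
    linearization φM (Twist.mk f s ⊗ₜ[S] m) = s • φM m := rfl

/-- `(M, φ_M)` has `E`-height `≤ r`: the linearization `1 ⊗ φ_M` is injective and its cokernel is
killed by `E^r`. -/
def HeightLE {S : Type u} [CommRing S] {f : S →+* S} {M : Type v} [AddCommGroup M]
    [Module S M] (E : S) (r : ℕ) (φM : M →ₛₗ[f] M) : Prop :=
  Function.Injective (linearization φM) ∧ ∀ m : M, ∃ x, linearization φM x = E ^ r • m

/-- `(M, φ_M)` has finite `E`-height. -/
def FiniteHeight {S : Type u} [CommRing S] {f : S →+* S} {M : Type v} [AddCommGroup M]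
    [Module S M] (E : S) (φM : M →ₛₗ[f] M) : Prop :=
  ∃ r : ℕ, HeightLE E r φM

end RelBK

end

/-!
Write `S = R₀⟦u⟧`, with its Frobenius `φ`. The ideal `P = freeFactorIdeal S M` of all `s ∈ S` such
that multiplication by `s` on `M` factors through a finite free module is nonzero, because `S` is a
domain and `M` is finitely generated, and `M[1/p]` is projective as soon as `P` contains a power of
`p` (`projective_of_pow_mem_freeFactorIdeal`).

Base rings are noetherian, `p`-adically complete, and the Frobenius of `R₀ / p` is flat
(`isGood_of_isIterated`): these properties are preserved by the operations that define base rings.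
The local criterion then gives that `φ` is flat on `R₀` and on `S` (`IsGood.flat_frobenius`,
`flat_frobS`), and `R₀ / p`, being connected with flat Frobenius, is a domain
(`HasFlatFrob.isDomain`). As `φ` is flat, the ideal attached to `S ⊗_φ M` is the pullback `P.map φ`,
and the finite height of `M` means that `P` and its pullback agree up to powers of `E`
(`HeightLE.freeFactorIdeal_mul`). The `p`-saturation `I` of `P` inherits this, and it remains to see
that its zero locus contains no point with `p ≠ 0` (`exists_natCast_pow_mem`).

Modulo `p`, the pullback of `I` is generated by `p`-th powers, so `E ^ n I ⊆ I ^ 2 + (p)` and a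
power of `E ≡ u ^ e` lies in `I + (p)`; the same argument on the locus `u = 0`, where `E(0)` is `p`
times a unit, puts a power of `p` into `I + (u)`. So on the zero locus of `I`, which is stable under
`φ` and its inverse away from the zero locus of `E`, the valuations of `u` and `p` bound each other.
Since `φ` raises `u` to its `p`-th power and fixes `p`, these bounds can be improved by factors of
`p` as long as they are weaker than the equality `e v(u) = v(p)` that holds where `E = 0`. The
resulting bounds, about `e v(u) ≥ p v(p)` and `e v(u) ≤ v(p)`, contradict each other. `Bound` states
such inequalities in terms of the membership of monomials in `I + (y ^ N)`.

That `E = u ^ e + p w` with a unit `w` is the statement that the minimal polynomial of a uniformizer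
is Eisenstein (`exists_minpoly_eq`).
-/

/-! ### Flatness in terms of relations -/

namespace RelBK

/-- Relations modulo `I` come from the source: if `∑ f(cᵢ) xᵢ ∈ I T` for `f : C → T`, then
`x = ∑ⱼ f(aⱼ) yⱼ` for vectors `aⱼ` over `C` with `∑ᵢ aᵢⱼ cᵢ ∈ I`. By the equational criterion this
says that `T / I T` is flat over `C / I`; for `I = 0` it is the flatness of `f`. -/
def LiftsRel {C T : Type*} [CommRing C] [CommRing T] (f : C →+* T) (I : Ideal C) : Prop :=
  ∀ (ι : Type) [Fintype ι] (c : ι → C) (x : ι → T), ∑ i, f (c i) * x i ∈ I.map f →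
    ∃ (κ : Type) (_ : Fintype κ) (a : ι → κ → C) (y : κ → T),
      (∀ i, x i = ∑ j, f (a i j) * y j) ∧ ∀ j, ∑ i, a i j * c i ∈ I

variable {C T : Type*} [CommRing C] [CommRing T] {f : C →+* T}

theorem flat_iff_liftsRel_bot : f.Flat ↔ LiftsRel f ⊥ := by
  let := f.toAlgebra
  have hsm : ∀ (c : C) (x : T), c • x = f c * x := fun _ _ => rfl
  change Module.Flat C T ↔ _
  constructor
  · intro h ι _ c x hx
    have h0 : ∑ i, c i • x i = 0 := by
      rw [Ideal.map_bot, Ideal.mem_bot] at hx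
      simpa only [hsm] using hx
    have h3 : Module.IsTrivialRelation c x :=
      Module.Flat.isTrivialRelation_of_sum_smul_eq_zero (f := c) (x := x) h0
    obtain ⟨k, a, y, h1, h2⟩ := h3
    refine ⟨Fin k, inferInstance, a, y, h1, fun j => ?_⟩
    rw [Ideal.mem_bot, ← h2 j]
    exact Finset.sum_congr rfl fun i _ => mul_comm _ _
  · intro h
    rw [Module.Flat.iff_forall_isTrivialRelation]
    intro l c x hx
    obtain ⟨κ, _, a, y, h1, h2⟩ := h (Fin l) c x (by
      rw [Ideal.map_bot, Ideal.mem_bot]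
      simpa only [hsm] using hx)
    let e := (Fintype.equivFin κ).symm
    refine ⟨Fintype.card κ, fun i j => a i (e j), fun j => y (e j), fun i => ?_, fun j => ?_⟩
    · rw [h1 i]
      exact (e.sum_comp fun j => f (a i j) * y j).symm
    · rw [← Ideal.mem_bot.1 (h2 (e j))]
      exact Finset.sum_congr rfl fun i _ => mul_comm _ _

theorem exists_sum_of_mem_map {I : Ideal C} {x : T} (hx : x ∈ I.map f) :
    ∃ (κ : Type) (_ : Fintype κ) (g : κ → C) (t : κ → T), (∀ k, g k ∈ I) ∧
      x = ∑ k, f (g k) * t k := by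
  obtain ⟨n, t, g, h⟩ := Submodule.mem_span_set'.1 hx
  choose g' hg' using fun i => (g i).2
  refine ⟨Fin n, inferInstance, g', t, fun k => (hg' k).1, ?_⟩
  rw [← h]
  exact Finset.sum_congr rfl fun i _ => by rw [(hg' i).2, smul_eq_mul, mul_comm]

theorem sum_mem_map {I : Ideal C} {κ : Type*} [Fintype κ] {g : κ → C} {t : κ → T}
    (hg : ∀ k, g k ∈ I) : ∑ k, f (g k) * t k ∈ I.map f :=
  Ideal.sum_mem _ fun k _ => Ideal.mul_mem_right _ _ (Ideal.mem_map_of_mem f (hg k))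

/-- It suffices to write `x` as a combination up to elements of `I T`. -/
theorem liftsRel_of_sub_mem {I : Ideal C} (h : ∀ (ι : Type) [Fintype ι] (c : ι → C) (x : ι → T),
    ∑ i, f (c i) * x i ∈ I.map f → ∃ (κ : Type) (_ : Fintype κ) (a : ι → κ → C) (y : κ → T),
      (∀ i, x i - ∑ j, f (a i j) * y j ∈ I.map f) ∧ ∀ j, ∑ i, a i j * c i ∈ I) :
    LiftsRel f I := by
  classical
  intro ι _ c x hx
  obtain ⟨κ, _, a, y, h1, h2⟩ := h ι c x hx
  choose μ _ g t hg ht using fun i => exists_sum_of_mem_map (h1 i)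
  refine ⟨κ ⊕ (Σ i, μ i), inferInstance,
    fun i => Sum.elim (a i) (fun s => if s.1 = i then g s.1 s.2 else 0),
    Sum.elim y (fun s => t s.1 s.2), fun i => ?_, ?_⟩
  · simp only [Fintype.sum_sum_type, Sum.elim_inl, Sum.elim_inr, Fintype.sum_sigma]
    rw [Finset.sum_eq_single i]
    · simp [← ht]
    · intro b _ hb; simp [hb]
    · simp
  · rintro (j | ⟨i, k⟩)
    · exact h2 j
    · simpa using Ideal.mul_mem_right _ _ (hg i k)

/-- A form of the local criterion of flatness: if `I T` lies in the Jacobson radical, it suffices to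
lift relations modulo all powers of `I`. -/
theorem flat_of_liftsRel_pow [IsNoetherianRing C] [IsNoetherianRing T] (I : Ideal C)
    (hI : I.map f ≤ Ideal.jacobson ⊥) (h : ∀ n, LiftsRel f (I ^ n)) : f.Flat := by
  rw [flat_iff_liftsRel_bot]
  intro ι _ c x hx
  let ℓ : (ι → C) →ₗ[C] C := Fintype.linearCombination C c
  have hℓ : ∀ a, ℓ a = ∑ i, a i * c i := fun a => by simp [ℓ, Fintype.linearCombination_apply]
  let N : Submodule T (ι → T) := Submodule.span T ((fun z i => f (z i)) '' {z | ℓ z = 0})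
  obtain ⟨k, hk⟩ := Ideal.exists_pow_inf_eq_pow_smul I (LinearMap.range ℓ)
  -- Artin-Rees: a syzygy modulo `I ^ (m + k)` is congruent to a syzygy modulo `I ^ m`
  have hAR : ∀ m a, ℓ a ∈ I ^ (m + k) →
      ∃ a' ∈ (I ^ m • ⊤ : Submodule C (ι → C)), ℓ (a - a') = 0 := by
    intro m a ha
    have h1 : ℓ a ∈ (I ^ (m + k) • ⊤ ⊓ LinearMap.range ℓ : Submodule C C) :=
      ⟨by simpa using ha, ⟨a, rfl⟩⟩
    rw [hk _ (Nat.le_add_left _ _), Nat.add_sub_cancel] at h1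
    have h2 : ℓ a ∈ I ^ m • LinearMap.range ℓ := Submodule.smul_mono le_rfl inf_le_right h1
    rw [LinearMap.range_eq_map, ← Submodule.map_smul''] at h2
    obtain ⟨a', ha', he⟩ := h2
    exact ⟨a', ha', by rw [map_sub, he, sub_self]⟩
  have hmap : ∀ (J : Ideal C) (a : ι → C), a ∈ (J • ⊤ : Submodule C (ι → C)) →
      (fun i => f (a i)) ∈ (J.map f • ⊤ : Submodule T (ι → T)) := by
    intro J a ha
    refine Submodule.smul_induction_on ha (fun r hr n _ => ?_) (fun a b ha hb => ?_)
    · have : (fun i => f ((r • n) i)) = f r • fun i => f (n i) := by ext i; simp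
      rw [this]
      exact Submodule.smul_mem_smul (Ideal.mem_map_of_mem f hr) trivial
    · have : (fun i => f ((a + b) i)) = (fun i => f (a i)) + fun i => f (b i) := by ext i; simp
      rw [this]
      exact add_mem ha hb
  have key : ∀ m, N.mkQ x ∈ ((I.map f) ^ m • ⊤ : Submodule T ((ι → T) ⧸ N)) := by
    intro m
    obtain ⟨κ, _, a, y, h1, h2⟩ := h (m + k) ι c x (by
      have : ∑ i, f (c i) * x i = 0 := by simpa using hx
      rw [this]; exact zero_mem _)
    choose a' ha' hz using fun j => hAR m (fun i => a i j) (by rw [hℓ]; exact h2 j)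
    have hx' : x = ∑ j, y j • (fun i => f ((fun i => a i j) i - a' j i))
        + ∑ j, y j • (fun i => f (a' j i)) := by
      rw [← Finset.sum_add_distrib]
      ext i
      simp only [h1 i, Finset.sum_apply, Pi.add_apply, Pi.smul_apply, smul_eq_mul, map_sub]
      exact Finset.sum_congr rfl fun j _ => by ring
    have hN : ∑ j, y j • (fun i => f ((fun i => a i j) i - a' j i)) ∈ N :=
      sum_mem fun j _ => Submodule.smul_mem _ _ (Submodule.subset_span ⟨_, hz j, rfl⟩)
    have hT : ∑ j, y j • (fun i => f (a' j i)) ∈ ((I.map f) ^ m • ⊤ : Submodule T (ι → T)) := by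
      rw [← Ideal.map_pow]
      exact sum_mem fun j _ => Submodule.smul_mem _ _ (hmap _ _ (ha' j))
    have hN' : N.mkQ _ = 0 := (Submodule.Quotient.mk_eq_zero N).2 hN
    rw [hx', map_add, hN', zero_add]
    have := Submodule.mem_map_of_mem (f := N.mkQ) hT
    rw [Submodule.map_smul''] at this
    exact Submodule.smul_mono le_rfl le_top this
  have hxN : x ∈ N := by
    have h0 := Ideal.iInf_pow_smul_eq_bot_of_le_jacobson (M := (ι → T) ⧸ N) (I.map f) hI
    have : N.mkQ x ∈ (⨅ i, (I.map f) ^ i • ⊤ : Submodule T ((ι → T) ⧸ N)) := by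
      simpa [Submodule.mem_iInf] using key
    rw [h0] at this
    exact (Submodule.Quotient.mk_eq_zero N).1 this
  obtain ⟨n, t, g, hg⟩ := Submodule.mem_span_set'.1 hxN
  choose g' hg' using fun i => (g i).2
  refine ⟨Fin n, inferInstance, fun i j => g' j i, t, fun i => ?_, fun j => ?_⟩
  · have := congrFun hg i
    rw [← this, Finset.sum_apply]
    refine Finset.sum_congr rfl fun j _ => ?_
    rw [Pi.smul_apply, ← congrFun (hg' j).2 i, smul_eq_mul, mul_comm]
  · have := (hg' j).1
    rw [← hℓ]; simpa using this

/-- For a principal ideal generated by an element that is regular on `T`, lifting relations modulo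
the ideal gives the same modulo all its powers. -/
theorem LiftsRel.span_singleton_pow {a : C} (ha : IsSMulRegular T (f a))
    (h : LiftsRel f (Ideal.span {a})) (n : ℕ) : LiftsRel f (Ideal.span {a} ^ n) := by
  induction n with
  | zero =>
    intro ι _ c x _
    classical
    exact ⟨ι, inferInstance, fun i j => if i = j then 1 else 0, x, fun i => by simp [apply_ite f],
      fun j => by simp⟩
  | succ n ih =>
    intro ι _ c x hx
    simp only [Ideal.span_singleton_pow, Ideal.map_span, Set.image_singleton, map_pow,
      Ideal.mem_span_singleton] at hx ih ⊢
    obtain ⟨t, ht⟩ := hx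
    obtain ⟨κ, _, b, y, h1, h2⟩ := ih ι c x (by
      simp only [Ideal.map_span, Set.image_singleton, map_pow, Ideal.mem_span_singleton]
      exact ⟨f a * t, by rw [ht]; ring⟩)
    choose d hd using fun j => Ideal.mem_span_singleton.1 (h2 j)
    have h3 : ∑ j, f (d j) * y j = f a * t := by
      have : f a ^ n * ∑ j, f (d j) * y j = f a ^ n * (f a * t) := by
        rw [← mul_assoc, ← pow_succ, ← ht, Finset.mul_sum]
        simp only [h1, Finset.mul_sum]
        rw [Finset.sum_comm]
        refine Finset.sum_congr rfl fun j _ => ?_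
        rw [← mul_assoc, ← map_pow, ← map_mul, ← hd, map_sum, Finset.sum_mul]
        exact Finset.sum_congr rfl fun i _ => by rw [map_mul]; ring
      exact (ha.pow n) (by simpa [smul_eq_mul] using this)
    obtain ⟨μ, _, e, w, h4, h5⟩ := h κ d y (by
      simp only [Ideal.map_span, Set.image_singleton, Ideal.mem_span_singleton]
      exact ⟨t, h3⟩)
    refine ⟨μ, inferInstance, fun i k => ∑ j, b i j * e j k, w, fun i => ?_, fun k => ?_⟩
    · simp only [h1 i, h4, map_sum, Finset.sum_mul, Finset.mul_sum, map_mul]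
      rw [Finset.sum_comm]
      exact Finset.sum_congr rfl fun j _ => Finset.sum_congr rfl fun k _ => by ring
    · obtain ⟨r, hr⟩ := Ideal.mem_span_singleton.1 (h5 k)
      refine ⟨r, ?_⟩
      rw [pow_succ, mul_assoc, ← hr, Finset.mul_sum]
      simp only [Finset.sum_mul]
      rw [Finset.sum_comm]
      refine Finset.sum_congr rfl fun j _ => ?_
      rw [mul_left_comm, ← hd j, Finset.mul_sum]
      exact Finset.sum_congr rfl fun i _ => by ring

/-- If `C / I` is a quotient of `B` and `T` is flat over `B`, then relations in `T` modulo `I` lift: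
`T / I T` is then a base change of `T`. -/
theorem liftsRel_map_of_flat_comp {B : Type*} [CommRing B] {g : B →+* C} (hf : (f.comp g).Flat)
    (I : Ideal B) (hg : ∀ c, ∃ b, c - g b ∈ I.map g) : LiftsRel f (I.map g) := by
  intro ι _ c x hx
  choose b hb using fun i => hg (c i)
  have h1 : ∑ i, f (g (b i)) * x i ∈ I.map (f.comp g) := by
    have h2 : ∑ i, f (c i - g (b i)) * x i ∈ (I.map g).map f := sum_mem_map hb
    have h3 := sub_mem hx h2
    rw [← Finset.sum_sub_distrib, Ideal.map_map] at h3
    convert h3 using 2 with i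
    rw [map_sub]; ring
  obtain ⟨μ, _, r, t, hr, ht⟩ := exists_sum_of_mem_map h1
  obtain ⟨κ, _, a, y, h4, h5⟩ := flat_iff_liftsRel_bot.1 hf (ι ⊕ μ) (Sum.elim b r)
    (Sum.elim x (fun k => - t k)) (by
      simp only [Fintype.sum_sum_type, Sum.elim_inl, Sum.elim_inr, mul_neg, Finset.sum_neg_distrib,
        RingHom.comp_apply] at ht ⊢
      rw [← ht, add_neg_cancel]; exact zero_mem _)
  refine ⟨κ, inferInstance, fun i j => g (a (Sum.inl i) j), y, fun i => ?_, fun j => ?_⟩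
  · simpa using h4 (Sum.inl i)
  · have h6 : ∑ i, a (Sum.inl i) j * b i = - ∑ k, a (Sum.inr k) j * r k := by
      have := h5 j
      simp only [Fintype.sum_sum_type, Sum.elim_inl, Sum.elim_inr, Ideal.mem_bot] at this
      exact eq_neg_of_add_eq_zero_left this
    have h7 : ∑ i, g (a (Sum.inl i) j) * g (b i) ∈ I.map g := by
      simp only [← map_mul, ← map_sum]
      rw [h6]
      exact Ideal.mem_map_of_mem g (neg_mem (sum_mem fun k _ => Ideal.mul_mem_left _ _ (hr k)))
    have h8 : ∑ i, g (a (Sum.inl i) j) * (c i - g (b i)) ∈ I.map g :=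
      sum_mem fun i _ => Ideal.mul_mem_left _ _ (hb i)
    convert add_mem h7 h8 using 1
    rw [← Finset.sum_add_distrib]
    exact Finset.sum_congr rfl fun i _ => by ring

/-- Lifting of relations modulo `I` for `f` is flatness of the induced map on quotients. -/
theorem liftsRel_of_flat_quotient {I : Ideal C} {J : Ideal T} (hJ : J = I.map f)
    (h : I ≤ J.comap f) (hf : (Ideal.quotientMap J f h).Flat) : LiftsRel f I := by
  subst hJ
  refine liftsRel_of_sub_mem fun ι _ c x hx => ?_
  obtain ⟨κ, _, a, y, h1, h2⟩ := flat_iff_liftsRel_bot.1 hf ι (fun i => Ideal.Quotient.mk _ (c i))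
    (fun i => Ideal.Quotient.mk _ (x i)) (by
      simp only [Ideal.quotientMap_mk, ← map_mul, ← map_sum]
      rw [Ideal.Quotient.eq_zero_iff_mem.2 hx]; exact zero_mem _)
  choose a' ha' using fun i j => Ideal.Quotient.mk_surjective (a i j)
  choose y' hy' using fun j => Ideal.Quotient.mk_surjective (y j)
  refine ⟨κ, inferInstance, a', y', fun i => ?_, fun j => ?_⟩
  · rw [← Ideal.Quotient.eq_zero_iff_mem, map_sub, h1 i, sub_eq_zero]
    simp only [map_sum, map_mul, ← ha', ← hy', Ideal.quotientMap_mk]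
  · have := h2 j
    rw [Ideal.mem_bot] at this
    rw [← Ideal.Quotient.eq_zero_iff_mem, ← this]
    simp only [map_sum, map_mul, ← ha']

end RelBK

/-! ### Rings with flat Frobenius -/

namespace RelBK

theorem liftsRel_of_flat {C T : Type*} [CommRing C] [CommRing T] {f : C →+* T} (hf : f.Flat)
    (I : Ideal C) : LiftsRel f I := by
  have := liftsRel_map_of_flat_comp (f := f) (g := RingHom.id C) (by simpa using hf) I
    fun c => ⟨c, by simp⟩
  rwa [Ideal.map_id] at this

theorem LiftsRel.flat_quotientMap {C T : Type*} [CommRing C] [CommRing T] {f : C →+* T}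
    {I : Ideal C} {J : Ideal T} (hJ : J = I.map f) (h : I ≤ J.comap f) (hf : LiftsRel f I) :
    (Ideal.quotientMap J f h).Flat := by
  rw [flat_iff_liftsRel_bot]
  intro ι _ c x hx
  choose c' hc' using fun i => Ideal.Quotient.mk_surjective (c i)
  choose x' hx' using fun i => Ideal.Quotient.mk_surjective (x i)
  obtain ⟨κ, _, a, y, h1, h2⟩ := hf ι c' x' (by
    rw [← hJ, ← Ideal.Quotient.eq_zero_iff_mem]
    rw [Ideal.map_bot, Ideal.mem_bot] at hx
    simpa only [map_sum, map_mul, ← hc', ← hx', Ideal.quotientMap_mk] using hx)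
  refine ⟨κ, inferInstance, fun i j => Ideal.Quotient.mk _ (a i j),
    fun j => Ideal.Quotient.mk _ (y j), fun i => ?_, fun j => ?_⟩
  · rw [← hx' i, h1 i]
    simp only [map_sum, map_mul, Ideal.quotientMap_mk]
  · rw [Ideal.mem_bot, ← Ideal.Quotient.eq_zero_iff_mem.2 (h2 j)]
    simp only [map_sum, map_mul, hc']

/-- A ring map with a finite dual basis is flat. -/
theorem flat_of_dual_basis {C T : Type*} [CommRing C] [CommRing T] (f : C →+* T) {κ : Type}
    [Fintype κ] (y : κ → T) (s : κ → T →+ C) (hs : ∀ t c x, s t (f c * x) = c * s t x)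
    (hy : ∀ x, x = ∑ t, f (s t x) * y t) : f.Flat := by
  rw [flat_iff_liftsRel_bot]
  intro ι _ c x hx
  rw [Ideal.map_bot, Ideal.mem_bot] at hx
  refine ⟨κ, inferInstance, fun i t => s t (x i), y, fun i => hy _, fun t => ?_⟩
  rw [Ideal.mem_bot, ← map_zero (s t), ← hx, map_sum]
  exact Finset.sum_congr rfl fun i _ => by rw [hs, mul_comm]

variable (p : ℕ)

/-- `B` has characteristic dividing `p` and its Frobenius `x ↦ x ^ p` is flat. The zero ring is
included. -/
def HasFlatFrob (B : Type*) [CommRing B] : Prop :=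
  ∃ F : B →+* B, (∀ x, F x = x ^ p) ∧ F.Flat

variable {p}

theorem HasFlatFrob.of_ringEquiv {B C : Type*} [CommRing B] [CommRing C] (e : B ≃+* C)
    (h : HasFlatFrob p B) : HasFlatFrob p C := by
  obtain ⟨F, hF, hfl⟩ := h
  refine ⟨(e : B →+* C).comp (F.comp (e.symm : C →+* B)), fun x => ?_, ?_⟩
  · simp [hF]
  · exact ((RingHom.Flat.of_bijective e.symm.bijective).comp hfl).comp
      (RingHom.Flat.of_bijective e.bijective)

/-- The Frobenius of a ring in which `p = 0`. -/
def powHom (p : ℕ) [hp : Fact p.Prime] (B : Type*) [CommRing B] (h : (p : B) = 0) : B →+* B where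
  toFun x := x ^ p
  map_one' := one_pow p
  map_mul' x y := mul_pow x y p
  map_zero' := zero_pow hp.out.ne_zero
  map_add' x y := by
    obtain ⟨r, hr⟩ := exists_add_pow_prime_eq hp.out x y
    rw [hr, h]; ring

@[simp] theorem powHom_apply (p : ℕ) [Fact p.Prime] (B : Type*) [CommRing B] (h : (p : B) = 0)
    (x : B) : powHom p B h x = x ^ p := rfl

/-- Flatness of the Frobenius ascends along étale algebras: the relative Frobenius
`B ⊗_{F, B} C → C` is a map between étale `B`-algebras, hence étale, hence flat. -/
theorem HasFlatFrob.of_etale {B : Type u} {C : Type v} [CommRing B] [CommRing C]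
    [Algebra B C] [Algebra.Etale B C] (hp : p.Prime) (hp0 : (p : B) = 0) (h : HasFlatFrob p B) :
    HasFlatFrob p C := by
  have := Fact.mk hp
  obtain ⟨F, hF, hfl⟩ := h
  have hpC : (p : C) = 0 := by rw [← map_natCast (algebraMap B C), hp0, map_zero]
  let G := powHom p C hpC
  refine ⟨G, fun _ => rfl, ?_⟩
  let _ : Algebra (Twist F) (Twist G) := inferInstanceAs (Algebra B C)
  have : Algebra.Etale (Twist F) (Twist G) := inferInstanceAs (Algebra.Etale B C)
  let _ : Algebra B (Twist G) := ((algebraMap C (Twist G)).comp (algebraMap B C)).toAlgebra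
  have : IsScalarTower B C (Twist G) := IsScalarTower.of_algebraMap_eq fun _ => rfl
  have : IsScalarTower B (Twist F) (Twist G) := IsScalarTower.of_algebraMap_eq fun x => by
    change (algebraMap B C x) ^ p = algebraMap B C (F x)
    rw [hF, map_pow]
  have : Module.Flat B (Twist F) := hfl
  let r : (Twist F) ⊗[B] C →ₐ[Twist F] Twist G := Algebra.TensorProduct.lift
    (Algebra.ofId (Twist F) (Twist G)) (IsScalarTower.toAlgHom B C (Twist G))
    (fun _ _ => Commute.all _ _)
  have hr : (r : (Twist F) ⊗[B] C →+* Twist G).Flat := by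
    let _ := (r : (Twist F) ⊗[B] C →+* Twist G).toAlgebra
    have : IsScalarTower (Twist F) ((Twist F) ⊗[B] C) (Twist G) :=
      IsScalarTower.of_algebraMap_eq fun x => (r.commutes x).symm
    have : Algebra.Etale ((Twist F) ⊗[B] C) (Twist G) := .of_restrictScalars (Twist F) _ _
    exact Algebra.Smooth.flat _ _
  have hi : (Algebra.TensorProduct.includeRight : C →ₐ[B] (Twist F) ⊗[B] C).toRingHom.Flat := by
    let _ := (Algebra.TensorProduct.includeRight : C →ₐ[B] (Twist F) ⊗[B] C).toRingHom.toAlgebra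
    change Module.Flat C ((Twist F) ⊗[B] C)
    have e : C ⊗[B] Twist F ≃ₗ[C] (Twist F) ⊗[B] C :=
      { TensorProduct.comm B C (Twist F) with
        map_smul' := fun c x => by
          induction x using TensorProduct.induction_on with
          | zero => simp
          | tmul a b =>
            change (TensorProduct.comm B C (Twist F)) ((c * a) ⊗ₜ b) = (1 ⊗ₜ c) * (b ⊗ₜ a)
            simp [Algebra.TensorProduct.tmul_mul_tmul]
          | add a b ha hb =>
            simp only [AddHom.toFun_eq_coe, LinearMap.coe_toAddHom, LinearEquiv.coe_coe,
              smul_add, map_add] at *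
            rw [ha, hb] }
    exact Module.Flat.of_linearEquiv e.symm
  have hG : G = (r : (Twist F) ⊗[B] C →+* Twist G).comp
      (Algebra.TensorProduct.includeRight : C →ₐ[B] (Twist F) ⊗[B] C).toRingHom := by
    ext x
    change G x = r (1 ⊗ₜ x)
    rw [Algebra.TensorProduct.lift_tmul, map_one, one_mul]
    rfl
  have := hi.comp hr
  rw [← hG] at this
  exact this

/-- The Frobenius of a localization is a localization of the Frobenius. -/
theorem HasFlatFrob.of_isLocalization {B : Type*} {C : Type*} [CommRing B] [CommRing C]
    [Algebra B C] (S : Submonoid B) [IsLocalization S C] (hp : p.Prime) (hp0 : (p : B) = 0)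
    (h : HasFlatFrob p B) : HasFlatFrob p C := by
  have := Fact.mk hp
  obtain ⟨F, hF, hfl⟩ := h
  have hpC : (p : C) = 0 := by rw [← map_natCast (algebraMap B C), hp0, map_zero]
  have hBC : (algebraMap B C).Flat := RingHom.flat_algebraMap_iff.2 (IsLocalization.flat C S)
  let G := powHom p C hpC
  refine ⟨G, fun _ => rfl, ?_⟩
  let _ : Algebra B (Twist G) := ((algebraMap C (Twist G)).comp (algebraMap B C)).toAlgebra
  have : IsScalarTower B C (Twist G) := IsScalarTower.of_algebraMap_eq fun _ => rfl
  change Module.Flat C (Twist G)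
  rw [Module.flat_iff_of_isLocalization C S]
  change ((algebraMap C (Twist G)).comp (algebraMap B C)).Flat
  have hc : (algebraMap C (Twist G)).comp (algebraMap B C) = (algebraMap B C).comp F := by
    ext x
    change algebraMap B C x ^ p = algebraMap B C (F x)
    rw [hF, map_pow]
  rw [hc]
  exact hfl.comp hBC

attribute [local instance] Polynomial.algebra in
/-- The map of polynomial rings induced by a flat map is flat. -/
theorem flat_polynomial_map {B C : Type*} [CommRing B] [CommRing C] {f : B →+* C} (hf : f.Flat) :
    (Polynomial.mapRingHom f).Flat := by
  let _ := f.toAlgebra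
  have : Module.Flat B C := hf
  change (algebraMap (Polynomial B) (Polynomial C)).Flat
  rw [RingHom.flat_algebraMap_iff]
  exact Module.Flat.isBaseChange B (Polynomial B) C (Polynomial C)
    (Algebra.IsPushout.out (R := B) (S := Polynomial B) (R' := C) (S' := Polynomial C))

open Polynomial in
theorem flat_polynomial_expand (B : Type*) [CommRing B] (hp : 0 < p) :
    (Polynomial.expand B p : B[X] →+* B[X]).Flat := by
  -- a polynomial is the sum over `t < p` of `X ^ t` times a polynomial in `X ^ p`
  let s : Fin p → B[X] →ₗ[B] B[X] := fun t =>
    Polynomial.lsum fun m => if m % p = t then Polynomial.monomial (m / p) else 0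
  have hs : ∀ t m b, s t (monomial m b) = if m % p = t then monomial (m / p) b else 0 := by
    intro t m b
    simp only [s, Polynomial.lsum_apply]
    rw [Polynomial.sum_monomial_index _ _ (by simp)]
    split_ifs <;> simp
  refine flat_of_dual_basis _ (fun t : Fin p => X ^ (t : ℕ)) (fun t => (s t).toAddMonoidHom) ?_ ?_
  · intro t c x
    change s t (expand B p c * x) = c * s t x
    induction c using Polynomial.induction_on' with
    | add a b ha hb => simp only [map_add, add_mul, ha, hb]
    | monomial n a =>
      induction x using Polynomial.induction_on' with
      | add a b ha hb => simp only [map_add, mul_add, ha, hb]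
      | monomial m b =>
        rw [expand_monomial, monomial_mul_monomial, hs, hs, Nat.mul_add_mod',
          Nat.mul_comm n p, Nat.mul_add_div hp]
        split_ifs
        · rw [monomial_mul_monomial]
        · rw [mul_zero]
  · intro x
    change x = ∑ t : Fin p, expand B p (s t x) * X ^ (t : ℕ)
    induction x using Polynomial.induction_on' with
    | add a b ha hb =>
      simp only [map_add, add_mul, Finset.sum_add_distrib]
      rw [← ha, ← hb]
    | monomial m b =>
      rw [Finset.sum_eq_single ⟨m % p, Nat.mod_lt _ hp⟩]
      · rw [hs, if_pos rfl, expand_monomial, monomial_mul_X_pow, Nat.div_add_mod']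
      · intro t _ ht
        rw [hs, if_neg (fun h => ht (Fin.ext h.symm)), map_zero, zero_mul]
      · simp

theorem HasFlatFrob.polynomial {B : Type*} [CommRing B] (hp : p.Prime) (hp0 : (p : B) = 0)
    (h : HasFlatFrob p B) : HasFlatFrob p (Polynomial B) := by
  have := Fact.mk hp
  obtain ⟨F, hF, hfl⟩ := h
  have hpC : (p : Polynomial B) = 0 := by
    rw [← map_natCast (algebraMap B (Polynomial B)), hp0, map_zero]
  refine ⟨(Polynomial.expand B p : Polynomial B →+* Polynomial B).comp (Polynomial.mapRingHom F),
    fun x => ?_, (flat_polynomial_map hfl).comp (flat_polynomial_expand B hp.pos)⟩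
  rw [← powHom_apply p (Polynomial B) hpC x]
  refine congrFun (congrArg DFunLike.coe (Polynomial.ringHom_ext' (g := powHom p _ hpC) ?_ ?_)) x
  · ext b; simp [hF]
  · simp

theorem HasFlatFrob.mvPolynomial {B : Type*} [CommRing B] (hp : p.Prime) (hp0 : (p : B) = 0)
    (h : HasFlatFrob p B) (d : ℕ) : HasFlatFrob p (MvPolynomial (Fin d) B) := by
  induction d with
  | zero => exact h.of_ringEquiv (MvPolynomial.isEmptyAlgEquiv B (Fin 0)).symm.toRingEquiv
  | succ d ih =>
    refine HasFlatFrob.of_ringEquiv (MvPolynomial.finSuccEquiv B d).symm.toRingEquiv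
      (ih.polynomial hp ?_)
    rw [← map_natCast (algebraMap B _), hp0, map_zero]

theorem HasFlatFrob.of_perfectRing {k : Type*} [Field k] [hp : Fact p.Prime] [CharP k p]
    [PerfectRing k p] : HasFlatFrob p k :=
  ⟨frobenius k p, fun _ => rfl, RingHom.Flat.of_bijective (bijective_frobenius k p)⟩

end RelBK

/-! ### Adic completions of noetherian rings -/

namespace RelBK

section

variable {A : Type u} [CommRing A] {I : Ideal A}

theorem evalₐ_eq_zero_iff (hI : I.FG) (n : ℕ) (c : AdicCompletion I A) :
    AdicCompletion.evalₐ I n c = 0 ↔ c ∈ (I ^ n).map (algebraMap A (AdicCompletion I A)) := by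
  have h1 : c ∈ (I ^ n).map (algebraMap A (AdicCompletion I A)) ↔
      c ∈ (I ^ n • ⊤ : Submodule A (AdicCompletion I A)) := by
    rw [Ideal.smul_top_eq_map, Submodule.restrictScalars_mem]
  have hle : I ^ n • ⊤ ≤ I ^ n := (Ideal.mul_top _).le
  have hinj : Function.Injective (Ideal.Quotient.factor hle) := by
    rw [RingHom.injective_iff_ker_eq_bot, Ideal.Quotient.factor_ker]
    exact Ideal.map_mk_eq_bot_of_le (Ideal.mul_top _).ge
  rw [h1, AdicCompletion.pow_smul_top_eq_ker_eval hI, LinearMap.mem_ker,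
    ← AdicCompletion.factor_eval_eq_evalₐ I c hle]
  exact map_eq_zero_iff _ hinj

theorem exists_sub_algebraMap_mem (hI : I.FG) (n : ℕ) (c : AdicCompletion I A) :
    ∃ a, c - algebraMap A _ a ∈ (I ^ n).map (algebraMap A (AdicCompletion I A)) := by
  obtain ⟨a, ha⟩ := Ideal.Quotient.mk_surjective (AdicCompletion.evalₐ I n c)
  refine ⟨a, (evalₐ_eq_zero_iff hI n _).1 ?_⟩
  rw [map_sub, ← ha, sub_eq_zero]
  exact (AdicCompletion.evalₐ_of I n a).symm

theorem isAdicComplete_map (hI : I.FG) :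
    IsAdicComplete (I.map (algebraMap A (AdicCompletion I A))) (AdicCompletion I A) :=
  (IsAdicComplete.map_algebraMap_iff _ _).2 (AdicCompletion.isAdicComplete hI)

end

/-- The completion of a noetherian ring is noetherian: with `I = (f₁, …, fᵣ)`, it is a quotient of
`A⟦X₁, …, Xᵣ⟧`, the completion of `A[X₁, …, Xᵣ]`, by `Xᵢ ↦ fᵢ`. -/
theorem isNoetherianRing_adicCompletion {A : Type u} [CommRing A] [IsNoetherianRing A]
    (I : Ideal A) : IsNoetherianRing (AdicCompletion I A) := by
  obtain ⟨r, f, hf⟩ := Submodule.fg_iff_exists_fin_generating_family.1 (IsNoetherian.noetherian I)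
  let P := MvPolynomial (Fin r) A
  let J : Ideal P := MvPolynomial.idealOfVars (Fin r) A
  let ev : P →+* A := (MvPolynomial.aeval f : P →ₐ[A] A)
  have hev : ∀ i, ev (MvPolynomial.X i) = f i := fun i => MvPolynomial.aeval_X f i
  have hJ : J.map ev = I := by
    simp only [J, MvPolynomial.idealOfVars, Ideal.map_span, ← Set.range_comp]
    rw [← hf]
    congr 2
    ext i
    exact hev i
  let P' := AdicCompletion J P
  have hP' : IsNoetherianRing P' :=
    isNoetherianRing_of_ringEquiv _ (MvPowerSeries.toAdicCompletionAlgEquiv (Fin r) A).toRingEquiv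
  have hle : ∀ n, J ^ n ≤ (I ^ n).comap ev := fun n => by
    rw [← Ideal.map_le_iff_le_comap, Ideal.map_pow, hJ]
  have hfg : J.FG := MvPolynomial.idealOfVars_fg _ _
  let q : ∀ n, P' →+* A ⧸ I ^ n := fun n =>
    (Ideal.quotientMap (I ^ n) ev (hle n)).comp (AdicCompletion.evalₐ J n : P' →+* P ⧸ J ^ n)
  have hq : ∀ {m n : ℕ} (h : m ≤ n), (Ideal.Quotient.factorPow I h).comp (q n) = q m := by
    intro m n h
    ext x
    obtain ⟨b, hb⟩ := exists_sub_algebraMap_mem hfg n x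
    have hb' : ∀ l ≤ n, AdicCompletion.evalₐ J l x = Ideal.Quotient.mk (J ^ l) b := by
      intro l hl
      rw [← sub_eq_zero]
      have := (evalₐ_eq_zero_iff hfg l _).2 (Ideal.map_mono (Ideal.pow_le_pow_right hl) hb)
      rwa [map_sub] at this
    simp only [q, RingHom.comp_apply, RingHom.coe_coe, hb' n le_rfl, hb' m h, Ideal.quotientMap_mk]
    rfl
  let g : P' →+* AdicCompletion I A := AdicCompletion.liftRingHom I q hq
  have hg : g.comp (algebraMap P P') = (algebraMap A (AdicCompletion I A)).comp ev := by
    refine RingHom.ext fun x => AdicCompletion.ext_evalₐ fun n => ?_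
    refine (AdicCompletion.evalₐ_liftRingHom I q hq n _).trans ?_
    change Ideal.quotientMap (I ^ n) ev (hle n) (AdicCompletion.evalₐ J n (algebraMap P P' x)) = _
    exact (congrArg _ (AdicCompletion.evalₐ_of J n x)).trans
      (AdicCompletion.evalₐ_of I n (ev x)).symm
  have hIfg : I.FG := IsNoetherian.noetherian I
  have hmap : (J.map (algebraMap P P')).map g = I.map (algebraMap A (AdicCompletion I A)) := by
    rw [Ideal.map_map, hg, ← Ideal.map_map, hJ]
  have h1 := isAdicComplete_map hfg
  have h2 := isAdicComplete_map hIfg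
  have h3 : IsHausdorff ((J.map (algebraMap P P')).map g) (AdicCompletion I A) := by
    rw [hmap]; infer_instance
  refine isNoetherianRing_of_surjective P' _ g
    (surjective_of_mk_map_comp_surjective (I := J.map (algebraMap P P')) g fun y => ?_)
  obtain ⟨y, rfl⟩ := Ideal.Quotient.mk_surjective y
  obtain ⟨a, ha⟩ := exists_sub_algebraMap_mem hIfg 1 y
  refine ⟨algebraMap P P' (MvPolynomial.C a), ?_⟩
  have hga : g (algebraMap P P' (MvPolynomial.C a)) = algebraMap A _ (ev (MvPolynomial.C a)) :=
    congrArg (fun k : P →+* AdicCompletion I A => k (MvPolynomial.C a)) hg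
  rw [RingHom.comp_apply, hga, Ideal.Quotient.mk_eq_mk_iff_sub_mem, hmap,
    ← neg_mem_iff, neg_sub]
  have hC : ev (MvPolynomial.C a) = a := MvPolynomial.aeval_C f a
  rw [hC]
  simpa using ha

/-- A noetherian ring that is complete for `I` is complete for every smaller ideal, as all ideals
are closed. -/
theorem isAdicComplete_of_le {R : Type*} [CommRing R] [IsNoetherianRing R] {I J : Ideal R}
    [hI : IsAdicComplete I R] (h : J ≤ I) : IsAdicComplete J R := by
  have hjac := IsAdicComplete.le_jacobson_bot I
  have h1 : IsHausdorff J R := IsHausdorff.of_le_jacobson J R (h.trans hjac)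
  refine { toIsHausdorff := h1, prec' := fun x hx => ?_ }
  have hle : ∀ n, (J ^ n • ⊤ : Ideal R) ≤ I ^ n • ⊤ := fun n =>
    Submodule.smul_mono_left (Ideal.pow_right_mono h n)
  obtain ⟨L, hL⟩ := hI.toIsPrecomplete.prec' x fun {m n} hmn => (hx hmn).mono (hle m)
  refine ⟨L, fun n => ?_⟩
  have h2 : IsHausdorff I (R ⧸ (J ^ n • ⊤ : Ideal R)) := IsHausdorff.of_le_jacobson I _ hjac
  rw [SModEq.def, ← sub_eq_zero]
  refine h2.haus _ fun m => ?_
  rw [SModEq.zero]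
  have h3 : x (max m n) - L ∈ (I ^ m • ⊤ : Ideal R) :=
    Submodule.smul_mono_left (Ideal.pow_le_pow_right (le_max_left m n))
      (SModEq.sub_mem.1 (hL (max m n)))
  have h4 : Submodule.Quotient.mk (p := (J ^ n • ⊤ : Ideal R)) (x n)
      = Submodule.Quotient.mk (x (max m n)) := hx (le_max_right m n)
  rw [h4, ← Submodule.Quotient.mk_sub]
  have h5 := Submodule.mem_map_of_mem (f := (J ^ n • ⊤ : Ideal R).mkQ) h3
  rw [Submodule.map_smul''] at h5
  exact Submodule.smul_mono le_rfl le_top h5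

end RelBK

/-! ### Base rings -/

namespace RelBK

theorem map_le_jacobson_of_surjective {A B : Type*} [CommRing A] [CommRing B] {f : A →+* B}
    (hf : Function.Surjective f) {I : Ideal A} (hI : I ≤ Ideal.jacobson ⊥) :
    I.map f ≤ Ideal.jacobson ⊥ := by
  intro x hx
  obtain ⟨x, hxI, rfl⟩ := (Ideal.mem_map_iff_of_surjective f hf).1 hx
  rw [Ideal.mem_jacobson_bot]
  intro y
  obtain ⟨y, rfl⟩ := hf y
  simpa using (Ideal.mem_jacobson_bot.1 (hI hxI) y).map f

/-- The properties that each of the operations defining base rings preserves: `A` is noetherian and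
`p`-adically complete, and the Frobenius of `A / p` is flat. -/
structure IsGood (p : ℕ) (A : Type*) [CommRing A] : Prop where
  noeth : IsNoetherianRing A
  complete : IsAdicComplete (Ideal.span {(p : A)}) A
  flatFrob : HasFlatFrob p (A ⧸ Ideal.span {(p : A)})

variable {p : ℕ}

theorem natCast_quotient_eq_zero (p : ℕ) (A : Type*) [CommRing A] :
    (p : A ⧸ Ideal.span {(p : A)}) = 0 := by
  rw [← map_natCast (Ideal.Quotient.mk (Ideal.span {(p : A)})), Ideal.Quotient.eq_zero_iff_mem]
  exact Ideal.mem_span_singleton_self _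

theorem map_span_natCast {A B : Type*} [CommRing A] [CommRing B] (f : A →+* B) :
    (Ideal.span {(p : A)}).map f = Ideal.span {(p : B)} := by
  rw [Ideal.map_span, Set.image_singleton, map_natCast]

/-- `B / p = A / p ⊗ B`. -/
noncomputable def quotientSpanEquiv (p : ℕ) (A B : Type*) [CommRing A] [CommRing B] [Algebra A B] :
    (A ⧸ Ideal.span {(p : A)}) ⊗[A] B ≃+* B ⧸ Ideal.span {(p : B)} :=
  (Algebra.TensorProduct.comm A (A ⧸ Ideal.span {(p : A)}) B).toRingEquiv.trans
    ((Algebra.TensorProduct.quotIdealMapEquivTensorQuot B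
      (Ideal.span {(p : A)})).symm.toRingEquiv.trans (Ideal.quotEquivOfEq (map_span_natCast _)))

theorem hasFlatFrob_quotient_of_etale {A B : Type u} [CommRing A] [CommRing B] [Algebra A B]
    [Algebra.Etale A B] (hp : p.Prime) (h : HasFlatFrob p (A ⧸ Ideal.span {(p : A)})) :
    HasFlatFrob p (B ⧸ Ideal.span {(p : B)}) :=
  (h.of_etale (C := (A ⧸ Ideal.span {(p : A)}) ⊗[A] B) hp
    (natCast_quotient_eq_zero p A)).of_ringEquiv (quotientSpanEquiv p A B)

theorem hasFlatFrob_quotient_of_isLocalization {A B : Type u} [CommRing A] [CommRing B]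
    [Algebra A B] (S : Submonoid A) [IsLocalization S B] (hp : p.Prime)
    (h : HasFlatFrob p (A ⧸ Ideal.span {(p : A)})) :
    HasFlatFrob p (B ⧸ Ideal.span {(p : B)}) :=
  (h.of_isLocalization (C := (A ⧸ Ideal.span {(p : A)}) ⊗[A] B)
    (Algebra.algebraMapSubmonoid (A ⧸ Ideal.span {(p : A)}) S) hp
    (natCast_quotient_eq_zero p A)).of_ringEquiv (quotientSpanEquiv p A B)

/-- Flatness of the Frobenius modulo `p` passes to completions, by the local criterion. -/
theorem hasFlatFrob_quotient_adicCompletion {A : Type u} [CommRing A] [IsNoetherianRing A]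
    (hp : p.Prime) (I : Ideal A) (h : HasFlatFrob p (A ⧸ Ideal.span {(p : A)})) :
    HasFlatFrob p (AdicCompletion I A ⧸ Ideal.span {(p : AdicCompletion I A)}) := by
  have := Fact.mk hp
  obtain ⟨F, hF, hfl⟩ := h
  have hN := isNoetherianRing_adicCompletion I
  let i := algebraMap A (AdicCompletion I A)
  let P : Ideal A := Ideal.span {(p : A)}
  let Q : Ideal (AdicCompletion I A) := Ideal.span {(p : AdicCompletion I A)}
  have hQ : Q = P.map i := (map_span_natCast i).symm
  let g : A ⧸ P →+* AdicCompletion I A ⧸ Q := Ideal.quotientMap Q i (hQ ▸ Ideal.le_comap_map)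
  have hi : i.Flat := RingHom.flat_algebraMap_iff.2 (AdicCompletion.flat_of_isNoetherian I)
  have hg : g.Flat := LiftsRel.flat_quotientMap hQ _ (liftsRel_of_flat hi P)
  let G := powHom p (AdicCompletion I A ⧸ Q) (natCast_quotient_eq_zero p _)
  refine ⟨G, fun _ => rfl, ?_⟩
  have hc : G.comp g = g.comp F := by
    ext x
    change g _ ^ p = g (F _)
    rw [hF, map_pow]
  let I' : Ideal (A ⧸ P) := I.map (Ideal.Quotient.mk P)
  have hmk : ∀ n, (I' ^ n).map g = ((I ^ n).map i).map (Ideal.Quotient.mk Q) := by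
    intro n
    rw [← Ideal.map_pow, Ideal.map_map, Ideal.map_map]
    rfl
  have hIfg : I.FG := IsNoetherian.noetherian I
  have hcomp := isAdicComplete_map hIfg
  refine flat_of_liftsRel_pow (I'.map g) ?_ fun n => ?_
  · have h1 : I'.map g ≤ Ideal.jacobson ⊥ := by
      rw [← pow_one I', hmk, pow_one]
      exact map_le_jacobson_of_surjective Ideal.Quotient.mk_surjective
        (IsAdicComplete.le_jacobson_bot _)
    refine le_trans ?_ h1
    rw [Ideal.map_le_iff_le_comap]
    intro x hx
    exact Ideal.pow_mem_of_mem _ hx p hp.pos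
  · rw [← Ideal.map_pow]
    refine liftsRel_map_of_flat_comp (hc ▸ hfl.comp hg) (I' ^ n) fun c => ?_
    obtain ⟨c, rfl⟩ := Ideal.Quotient.mk_surjective c
    obtain ⟨a, ha⟩ := exists_sub_algebraMap_mem hIfg n c
    refine ⟨Ideal.Quotient.mk P a, ?_⟩
    rw [hmk]
    exact Ideal.mem_map_of_mem (Ideal.Quotient.mk Q) ha

theorem isGood_adicCompletion {A : Type u} [CommRing A] [IsNoetherianRing A]
    (hp : p.Prime) (I : Ideal A) (hI : (p : A) ∈ I)
    (h : HasFlatFrob p (A ⧸ Ideal.span {(p : A)})) : IsGood p (AdicCompletion I A) := by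
  have hN := isNoetherianRing_adicCompletion I
  have hcomp := isAdicComplete_map (IsNoetherian.noetherian I : I.FG)
  refine ⟨hN, isAdicComplete_of_le (I := I.map (algebraMap A (AdicCompletion I A))) ?_,
    hasFlatFrob_quotient_adicCompletion hp I h⟩
  rw [Ideal.span_singleton_le_iff_mem, ← map_natCast (algebraMap A (AdicCompletion I A))]
  exact Ideal.mem_map_of_mem _ hI

theorem IsGood.of_ringEquiv {A B : Type*} [CommRing A] [CommRing B] (e : A ≃+* B)
    (h : IsGood p A) : IsGood p B := by
  have he : (Ideal.span {(p : A)}).map e.toRingHom = Ideal.span {(p : B)} := map_span_natCast _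
  have := h.noeth
  refine ⟨isNoetherianRing_of_ringEquiv A e, ?_, ?_⟩
  · rw [← he]
    exact (IsAdicComplete.congr_ringEquiv _ e).2 h.complete
  · exact h.flatFrob.of_ringEquiv (Ideal.quotientEquiv _ _ e he.symm)

variable {k : Type u} [Field k] [CharP k p] [hp : Fact p.Prime] [PerfectRing k p]

theorem isGood_of_isIterated {d : ℕ} {A : Type u} [CommRing A]
    [Algebra (CLaurent p d (WittVector p k)) A] (h : IsIterated p d (WittVector p k) A) :
    IsGood p A := by
  induction h with
  | base =>
    let P := MvPolynomial (Fin d) (WittVector p k)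
    have hk : HasFlatFrob p (WittVector p k ⧸ Ideal.span {(p : WittVector p k)}) :=
      (HasFlatFrob.of_perfectRing (k := k)).of_ringEquiv WittVector.quotientPEquiv.symm
    have hP : HasFlatFrob p (P ⧸ Ideal.span {(p : P)}) := by
      have h1 := hk.mvPolynomial hp.out (natCast_quotient_eq_zero p _) d
      refine h1.of_ringEquiv ((MvPolynomial.quotientEquivQuotientMvPolynomial _).toRingEquiv.trans
        (Ideal.quotEquivOfEq (map_span_natCast _)))
    have : IsNoetherianRing (Laurent d (WittVector p k)) :=
      IsLocalization.isNoetherianRing (Submonoid.powers (∏ i : Fin d, (MvPolynomial.X i : P))) _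
        inferInstance
    exact isGood_adicCompletion hp.out _ (Ideal.mem_span_singleton_self _)
      (hasFlatFrob_quotient_of_isLocalization
        (Submonoid.powers (∏ i : Fin d, (MvPolynomial.X i : P))) hp.out hP)
  | etale A B _ ih =>
    have := ih.noeth
    have : IsNoetherianRing B := Algebra.FiniteType.isNoetherianRing A B
    exact isGood_adicCompletion hp.out _ (Ideal.mem_span_singleton_self _)
      (hasFlatFrob_quotient_of_etale hp.out ih.flatFrob)
  | localization A S _ ih =>
    have := ih.noeth
    have : IsNoetherianRing (Localization S) := IsLocalization.isNoetherianRing S _ inferInstance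
    exact isGood_adicCompletion hp.out _ (Ideal.mem_span_singleton_self _)
      (hasFlatFrob_quotient_of_isLocalization S hp.out ih.flatFrob)
  | completion A I hI _ ih =>
    have := ih.noeth
    exact isGood_adicCompletion hp.out I hI ih.flatFrob
  | iso A B e _ ih => exact ih.of_ringEquiv e.toRingEquiv

end RelBK

/-! ### Flatness of the Frobenius lifts -/

namespace RelBK

/-- If `x ↦ x ^ p` is flat, then the annihilator `J` of `s` is idempotent: if `x s = 0` then
`x F(s) = 0`, so `x` is a combination of `p`-th powers of elements of `J`. Hence a connected
noetherian ring with flat Frobenius is a domain. -/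
theorem HasFlatFrob.isDomain {p : ℕ} {B : Type*} [CommRing B] [Nontrivial B] [IsNoetherianRing B]
    (hp : p.Prime) (h : HasFlatFrob p B) (hB : ∀ e : B, e * e = e → e = 0 ∨ e = 1) :
    IsDomain B := by
  obtain ⟨F, hF, hfl⟩ := h
  have : NoZeroDivisors B := by
    refine ⟨fun {s t} hst => ?_⟩
    let J : Ideal B := LinearMap.ker (LinearMap.mulRight B s)
    have hJ : ∀ x, x ∈ J ↔ x * s = 0 := fun x => by simp [J]
    have hJJ : IsIdempotentElem J := by
      refine le_antisymm Ideal.mul_le_left fun x hx => ?_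
      obtain ⟨κ, _, a, y, h1, h2⟩ := flat_iff_liftsRel_bot.1 hfl Unit (fun _ => s) (fun _ => x) (by
        have hx' := (hJ x).1 hx
        obtain ⟨m, hm⟩ := Nat.exists_eq_add_of_lt hp.pos
        simp only [Finset.univ_unique, Finset.sum_const, Finset.card_singleton, one_smul, hF,
          Ideal.map_bot, Ideal.mem_bot]
        rw [hm, pow_succ, mul_assoc, mul_comm s x, hx', mul_zero])
      rw [h1 ()]
      refine sum_mem fun j _ => Ideal.mul_mem_right _ _ ?_
      have ha : a () j ∈ J := (hJ _).2 (by simpa using h2 j)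
      rw [hF, ← pow_two]
      exact Ideal.pow_le_pow_right hp.two_le (Ideal.pow_mem_pow ha p)
    obtain ⟨e, he, hJe⟩ := (Ideal.isIdempotentElem_iff_of_fg J (IsNoetherian.noetherian J)).1 hJJ
    have hes : e * s = 0 := (hJ e).1 (by rw [hJe]; exact Ideal.mem_span_singleton_self e)
    rcases hB e he with rfl | rfl
    · right
      have : t ∈ J := (hJ t).2 (by rw [mul_comm, hst])
      simpa [hJe] using this
    · left; simpa using hes
  exact NoZeroDivisors.to_isDomain B

/-- Idempotents lift along complete ideals. -/
theorem eq_zero_or_one_of_isAdicComplete {R : Type*} [CommRing R] [IsDomain R] (I : Ideal R)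
    [IsAdicComplete I R] (e : R ⧸ I) (he : e * e = e) : e = 0 ∨ e = 1 := by
  obtain ⟨a, rfl⟩ := Ideal.Quotient.mk_surjective e
  have ha : a * a - a ∈ I := by
    rw [← Ideal.Quotient.eq_zero_iff_mem, map_sub, map_mul, he, sub_self]
  obtain ⟨b, hb, hba⟩ := HenselianRing.is_henselian (I := I)
    (Polynomial.X * Polynomial.X - Polynomial.X)
    (by monicity!) a (by simpa using ha) (by
      refine IsUnit.of_mul_eq_one (Ideal.Quotient.mk I (2 * a - 1)) ?_
      rw [← map_mul, ← map_one (Ideal.Quotient.mk I), Ideal.Quotient.mk_eq_mk_iff_sub_mem]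
      have : (Polynomial.derivative (Polynomial.X * Polynomial.X - Polynomial.X)).eval a *
          (2 * a - 1) - 1 = 4 * (a * a - a) := by
        simp; ring
      rw [this]
      exact Ideal.mul_mem_left _ _ ha)
  have hb' : b * (b - 1) = 0 := by
    have : b * b - b = 0 := by simpa [Polynomial.IsRoot] using hb
    rw [← this]; ring
  have hab : Ideal.Quotient.mk I a = Ideal.Quotient.mk I b := by
    rw [eq_comm, Ideal.Quotient.mk_eq_mk_iff_sub_mem]; exact hba
  rcases mul_eq_zero.1 hb' with h | h
  · left; rw [hab, h, map_zero]
  · right; rw [hab, sub_eq_zero.1 h, map_one]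

variable {p : ℕ} {R : Type*} [CommRing R]

theorem IsGood.isDomain_quotient [IsDomain R] (hp : p.Prime) (h : IsGood p R) :
    IsDomain (R ⧸ Ideal.span {(p : R)}) := by
  have := h.noeth
  have := h.complete
  have : Nontrivial (R ⧸ Ideal.span {(p : R)}) := by
    rw [Ideal.Quotient.nontrivial_iff]
    intro ht
    have hj := IsAdicComplete.le_jacobson_bot (Ideal.span {(p : R)})
    rw [ht, top_le_iff, Ideal.jacobson_eq_top_iff] at hj
    exact bot_ne_top hj
  exact h.flatFrob.isDomain hp (eq_zero_or_one_of_isAdicComplete _)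

/-- A lift of a flat Frobenius is flat, by the local criterion. -/
theorem IsGood.flat_frobenius [IsDomain R] (h : IsGood p R) (hp0 : (p : R) ≠ 0)
    {φ : R →+* R} (hφ : ∀ x, φ x - x ^ p ∈ Ideal.span {(p : R)}) : φ.Flat := by
  have := h.noeth
  have := h.complete
  have hm : (Ideal.span {(p : R)}).map φ = Ideal.span {(p : R)} := map_span_natCast φ
  refine flat_of_liftsRel_pow (Ideal.span {(p : R)}) ?_ (LiftsRel.span_singleton_pow ?_ ?_)
  · rw [hm]
    exact IsAdicComplete.le_jacobson_bot _
  · rw [map_natCast]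
    intro x y hxy
    exact mul_left_cancel₀ hp0 hxy
  · obtain ⟨F, hF, hfl⟩ := h.flatFrob
    have hle : Ideal.span {(p : R)} ≤ (Ideal.span {(p : R)}).comap φ := by
      rw [← Ideal.map_le_iff_le_comap, hm]
    refine liftsRel_of_flat_quotient hm.symm hle ?_
    convert hfl
    ext x
    rw [RingHom.comp_apply, RingHom.comp_apply, Ideal.quotientMap_mk, hF, ← map_pow]
    exact Ideal.Quotient.mk_eq_mk_iff_sub_mem _ _ |>.2 (hφ x)

open PowerSeries

variable [hp : Fact p.Prime]

theorem frobS_apply (φ : R →+* R) (f : R⟦X⟧) :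
    frobS p φ f = PowerSeries.expand p hp.out.ne_zero (PowerSeries.map φ f) := rfl

theorem frobS_X (φ : R →+* R) : frobS p φ (X : R⟦X⟧) = X ^ p := by
  simp [frobS_apply]

theorem frobS_C (φ : R →+* R) (a : R) : frobS p φ (C a : R⟦X⟧) = C (φ a) := by
  rw [frobS_apply, map_C, expand_C]

theorem constantCoeff_frobS (φ : R →+* R) (f : R⟦X⟧) :
    constantCoeff (frobS p φ f) = φ (constantCoeff f) := by
  rw [frobS_apply, constantCoeff_expand]
  simp only [← coeff_zero_eq_constantCoeff_apply, coeff_map]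

theorem exists_eq_C_add_X_mul (f : R⟦X⟧) : ∃ g, f = C (constantCoeff f) + X * g := by
  have : (X : R⟦X⟧) ∣ f - C (constantCoeff f) := by
    rw [X_dvd_iff]; simp
  obtain ⟨g, hg⟩ := this
  exact ⟨g, by rw [← hg]; ring⟩

/-- `φ` on `R⟦u⟧` is flat: modulo `u` its target is `R[u] / u ^ p`, a finite free module over `R`
twisted by `φ`. -/
theorem flat_frobS [IsNoetherianRing R] {φ : R →+* R} (hφ : φ.Flat) : (frobS p φ).Flat := by
  have hm : (Ideal.span {(X : R⟦X⟧)}).map (frobS p φ) = Ideal.span {(X : R⟦X⟧) ^ p} := by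
    rw [Ideal.map_span, Set.image_singleton, frobS_X]
  refine flat_of_liftsRel_pow (Ideal.span {(X : R⟦X⟧)}) ?_ (LiftsRel.span_singleton_pow ?_ ?_)
  · rw [hm, Ideal.span_singleton_le_iff_mem, Ideal.mem_jacobson_bot]
    intro y
    rw [PowerSeries.isUnit_iff_constantCoeff]
    simp [hp.out.ne_zero]
  · rw [frobS_X]
    intro x y hxy
    have hxy' : X ^ p * x = X ^ p * y := hxy
    ext n
    simpa [PowerSeries.coeff_X_pow_mul] using congrArg (PowerSeries.coeff (n + p)) hxy'
  · refine liftsRel_of_sub_mem fun ι _ c x hx => ?_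
    rw [hm] at hx ⊢
    rw [Ideal.mem_span_singleton, PowerSeries.X_pow_dvd_iff] at hx
    have hcoeff : ∀ (c x : R⟦X⟧) m, m < p →
        coeff m (frobS p φ c * x) = φ (constantCoeff c) * coeff m x := by
      intro c x m hmp
      obtain ⟨g, hg⟩ := exists_eq_C_add_X_mul c
      conv_lhs => rw [hg]
      rw [map_add, map_mul (frobS p φ), frobS_C, frobS_X, add_mul, mul_assoc, map_add,
        coeff_X_pow_mul', if_neg (by omega), add_zero, coeff_C_mul]
    have hrel : ∀ t : Fin p, ∑ i, φ (constantCoeff (c i)) * coeff t (x i) ∈ Ideal.map φ ⊥ := by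
      intro t
      rw [Ideal.map_bot, Ideal.mem_bot, ← hx t t.2, map_sum]
      exact Finset.sum_congr rfl fun i _ => (hcoeff _ _ _ t.2).symm
    choose κ _ a y h1 h2 using fun t => flat_iff_liftsRel_bot.1 hφ ι _ _ (hrel t)
    refine ⟨Σ t, κ t, inferInstance, fun i s => C (a s.1 i s.2),
      fun s => C (y s.1 s.2) * X ^ (s.1 : ℕ), fun i => ?_, fun s => ?_⟩
    · rw [Ideal.mem_span_singleton, PowerSeries.X_pow_dvd_iff]
      intro m hmp
      rw [map_sub, map_sum, Fintype.sum_sigma, Finset.sum_eq_single ⟨m, hmp⟩, sub_eq_zero,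
        h1 ⟨m, hmp⟩ i]
      · refine Finset.sum_congr rfl fun j _ => ?_
        rw [hcoeff _ _ _ hmp, constantCoeff_C, coeff_C_mul, coeff_X_pow_self, mul_one]
      · intro t _ ht
        refine Finset.sum_eq_zero fun j _ => ?_
        rw [hcoeff _ _ _ hmp, coeff_C_mul, coeff_X_pow,
          if_neg (fun h => ht (Fin.ext h.symm)), mul_zero, mul_zero]
      · simp
    · rw [Ideal.mem_span_singleton, X_dvd_iff, map_sum]
      rw [← Ideal.mem_bot.1 (h2 s.1 s.2)]
      exact Finset.sum_congr rfl fun i _ => by simp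

end RelBK

/-! ### The ideal of multiplications that factor through a free module -/

namespace RelBK

section

variable {S : Type*} [CommRing S]

/-- The ideal of all `s` such that multiplication by `s` on `M` factors through a finite free
module. It is the unit ideal if and only if `M` is finitely generated projective, and plays the role
of a Fitting ideal: it is compatible with flat base change and with isogenies. -/
def freeFactorIdeal (S : Type*) [CommRing S] (M : Type*) [AddCommGroup M] [Module S M] :
    Ideal S where
  carrier := {s | ∃ (κ : Type) (_ : Fintype κ) (α : κ → M →ₗ[S] S) (x : κ → M),
    ∀ m, s • m = ∑ i, α i m • x i}
  zero_mem' := ⟨Empty, inferInstance, Empty.elim, Empty.elim, by simp⟩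
  add_mem' := by
    rintro s t ⟨κ, _, α, x, h⟩ ⟨μ, _, β, y, h'⟩
    exact ⟨κ ⊕ μ, inferInstance, Sum.elim α β, Sum.elim x y, fun m => by
      simp [add_smul, h m, h' m]⟩
  smul_mem' := by
    rintro c s ⟨κ, _, α, x, h⟩
    exact ⟨κ, inferInstance, fun i => c • α i, x, fun m => by
      simp [mul_smul, h m, Finset.smul_sum]⟩

/-- If `c` factors through `A` as an endomorphism of `B`, then `c` maps the ideal of `A` to that
of `B`. -/
theorem mul_mem_freeFactorIdeal_of_comp {A B : Type*} [AddCommGroup A] [Module S A]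
    [AddCommGroup B] [Module S B] (f : A →ₗ[S] B) (g : B →ₗ[S] A) {c s : S}
    (hfg : ∀ b, f (g b) = c • b) (hs : s ∈ freeFactorIdeal S A) :
    c * s ∈ freeFactorIdeal S B := by
  obtain ⟨κ, _, α, x, h⟩ := hs
  refine ⟨κ, inferInstance, fun i => α i ∘ₗ g, fun i => f (x i), fun b => ?_⟩
  rw [mul_comm, mul_smul, ← hfg, ← map_smul, h, map_sum]
  simp

theorem freeFactorIdeal_ne_bot [IsDomain S] (M : Type*) [AddCommGroup M] [Module S M]
    [Module.Finite S M] : freeFactorIdeal S M ≠ ⊥ := by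
  classical
  -- multiplication by a suitable `c ≠ 0` maps `M` into the span of a maximal independent family
  obtain ⟨n, v, hv⟩ := Submodule.fg_iff_exists_fin_generating_family.1
    (Module.finite_def.1 ‹Module.Finite S M›)
  obtain ⟨s, hs, hmax⟩ := exists_maximal_linearIndepOn S v
  have h1 : ∀ i, ∃ a : S, a ≠ 0 ∧ a • v i ∈ Submodule.span S (v '' s) := by
    intro i
    by_cases hi : i ∈ s
    · exact ⟨1, one_ne_zero, by rw [one_smul]; exact Submodule.subset_span ⟨i, hi, rfl⟩⟩
    · exact hmax i hi
  choose a ha0 ha using h1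
  let c := ∏ i, a i
  have hc : c ≠ 0 := Finset.prod_ne_zero_iff.2 fun i _ => ha0 i
  have hr : Set.range (fun i : s => v i) = v '' s := by
    ext; simp
  have hcm : ∀ m : M, c • m ∈ Submodule.span S (Set.range fun i : s => v i) := by
    intro m
    rw [hr]
    have hm : m ∈ Submodule.span S (Set.range v) := hv ▸ trivial
    induction hm using Submodule.span_induction with
    | mem x hx =>
      obtain ⟨i, rfl⟩ := hx
      obtain ⟨d, hd⟩ : a i ∣ c := Finset.dvd_prod_of_mem _ (Finset.mem_univ i)
      rw [hd, mul_comm, mul_smul]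
      exact Submodule.smul_mem _ _ (ha i)
    | zero => rw [smul_zero]; exact zero_mem _
    | add x y _ _ hx hy => rw [smul_add]; exact add_mem hx hy
    | smul r x _ hx => rw [smul_comm]; exact Submodule.smul_mem _ _ hx
  have hli : LinearIndependent S (fun i : s => v i) := hs
  let q : M →ₗ[S] Submodule.span S (Set.range fun i : s => v i) :=
    LinearMap.codRestrict _ (LinearMap.lsmul S M c) hcm
  let b := Module.Basis.span hli
  refine fun h => hc ?_
  rw [← Ideal.mem_bot, ← h]
  refine ⟨s, Fintype.ofFinite s, fun i => b.coord i ∘ₗ q, fun i => v i, fun m => ?_⟩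
  let _ := Fintype.ofFinite s
  have := congrArg Subtype.val (b.sum_repr (q m))
  rw [Submodule.coe_sum] at this
  refine (this.symm.trans ?_ : c • m = _)
  refine Finset.sum_congr rfl fun i _ => ?_
  rw [Submodule.coe_smul]
  congr 1
  exact congrArg Subtype.val (Module.Basis.span_apply hli i)

/-- Annihilators of elements are compatible with flat base change. -/
theorem mem_map_of_tmul_eq_zero {T : Type*} [CommRing T] [Algebra S T] [Module.Flat S T]
    {X : Type*} [AddCommGroup X] [Module S X] (x : X) (t : T) (h : t ⊗ₜ[S] x = 0) :
    t ∈ Ideal.map (algebraMap S T) (LinearMap.ker (LinearMap.toSpanSingleton S X x)) := by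
  let ℓ := LinearMap.toSpanSingleton S X x
  have hex := Module.Flat.lTensor_exact T (LinearMap.exact_subtype_ker_map ℓ)
  obtain ⟨z, hz⟩ := (hex (t ⊗ₜ (1 : S))).1 (by simpa [ℓ] using h)
  have h2 : ∀ z : T ⊗[S] (LinearMap.ker ℓ), TensorProduct.rid S T (LinearMap.lTensor T
      (LinearMap.ker ℓ).subtype z) ∈ Ideal.map (algebraMap S T) (LinearMap.ker ℓ) := by
    intro z
    induction z using TensorProduct.induction_on with
    | zero => simp
    | tmul a b =>
      simp only [LinearMap.lTensor_tmul, TensorProduct.rid_tmul, Algebra.smul_def]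
      exact Ideal.mul_mem_right _ _ (Ideal.mem_map_of_mem _ b.2)
    | add a b ha hb => rw [map_add, map_add]; exact add_mem ha hb
  have := h2 z
  rwa [hz, TensorProduct.rid_tmul, one_smul] at this

/-- The formation of `freeFactorIdeal` commutes with flat base change: it is the annihilator of the
class of the identity in `End M` modulo the endomorphisms that factor through a free module. This is
the inclusion that needs flatness; the other one is `mem_freeFactorIdeal_baseChange`. -/
theorem mem_map_freeFactorIdeal [IsNoetherianRing S] {T : Type*} [CommRing T] [Algebra S T]
    [Module.Flat S T] {M : Type*} [AddCommGroup M] [Module S M] [Module.Finite S M] {t : T}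
    (ht : t ∈ freeFactorIdeal T (T ⊗[S] M)) :
    t ∈ (freeFactorIdeal S M).map (algebraMap S T) := by
  classical
  obtain ⟨κ, _, α, x, h⟩ := ht
  have := Module.finitePresentation_of_finite S M
  -- by flatness, the functionals on `T ⊗ M` are combinations of functionals on `M`
  have hα : ∀ i, ∃ (n : ℕ) (β : M →ₗ[S] (Fin n →₀ S)) (γ : (Fin n →₀ S) →ₗ[S] T),
      ((α i).restrictScalars S) ∘ₗ (TensorProduct.mk S T M 1) = γ ∘ₗ β := fun i =>
    Module.Flat.exists_factorization_of_finitePresentation _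
  choose n β γ hβ using hα
  have hβ' : ∀ i m, α i (1 ⊗ₜ m) = ∑ j, algebraMap S T (β i m j) * γ i (Finsupp.single j 1) := by
    intro i m
    have h1 := LinearMap.congr_fun (hβ i) m
    refine h1.trans ?_
    rw [LinearMap.comp_apply]
    conv_lhs => rw [← Finsupp.univ_sum_single (β i m), map_sum]
    refine Finset.sum_congr rfl fun j _ => ?_
    rw [← Algebra.smul_def, ← map_smul, Finsupp.smul_single, smul_eq_mul, mul_one]
  obtain ⟨k, e, he⟩ := Submodule.fg_iff_exists_fin_generating_family.1
    (Module.finite_def.1 ‹Module.Finite S M›)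
  let X := Fin k → M
  -- evaluation on generators identifies endomorphisms of `M` with vectors in `M ^ k`
  let L : Submodule S X := Submodule.span S
    (Set.range fun q : (M →ₗ[S] S) × M => fun b => q.1 (e b) • q.2)
  have hker : LinearMap.ker (LinearMap.toSpanSingleton S (X ⧸ L) (L.mkQ e)) ≤
      freeFactorIdeal S M := by
    intro s hs
    have hs' : s • e ∈ L := by
      rw [LinearMap.mem_ker, LinearMap.toSpanSingleton_apply, ← map_smul] at hs
      exact (Submodule.Quotient.mk_eq_zero L).1 hs
    obtain ⟨l, c, q, hq⟩ := Submodule.mem_span_set'.1 hs'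
    choose q' hq' using fun i => (q i).2
    refine ⟨Fin l, inferInstance, fun i => c i • (q' i).1, fun i => (q' i).2, fun m => ?_⟩
    have hm : m ∈ Submodule.span S (Set.range e) := he ▸ trivial
    induction hm using Submodule.span_induction with
    | mem y hy =>
      obtain ⟨b, rfl⟩ := hy
      have := congrFun hq b
      rw [Pi.smul_apply, Finset.sum_apply] at this
      rw [← this]
      refine Finset.sum_congr rfl fun i _ => ?_
      rw [Pi.smul_apply, ← congrFun (hq' i) b, LinearMap.smul_apply, smul_eq_mul, mul_smul]
    | zero => simp
    | add y z _ _ hy hz => simp [smul_add, hy, hz, mul_add, add_smul, Finset.sum_add_distrib]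
    | smul r y _ hy =>
      rw [smul_comm, hy, Finset.smul_sum]
      exact Finset.sum_congr rfl fun i _ => by rw [map_smul, smul_eq_mul, mul_smul]
  refine Ideal.map_mono hker (mem_map_of_tmul_eq_zero _ _ ?_)
  let π : T ⊗[S] X →ₗ[S] T ⊗[S] (X ⧸ L) := LinearMap.lTensor T L.mkQ
  have hπ : ∀ (β : M →ₗ[S] S) (y : T ⊗[S] M), π ((TensorProduct.piRight S S T fun _ => M).symm
      (fun b => β (e b) • y)) = 0 := by
    intro β y
    induction y using TensorProduct.induction_on with
    | zero => simp only [smul_zero]; exact (congrArg π (map_zero _)).trans (map_zero _)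
    | tmul a m =>
      have : (TensorProduct.piRight S S T fun _ => M).symm (fun b => β (e b) • (a ⊗ₜ[S] m)) =
          a ⊗ₜ (fun b => β (e b) • m) := by
        rw [LinearEquiv.symm_apply_eq]
        ext b
        simp
      rw [this, LinearMap.lTensor_tmul]
      have h0 : L.mkQ (fun b => β (e b) • m) = 0 :=
        (Submodule.Quotient.mk_eq_zero L).2 (Submodule.subset_span ⟨(β, m), rfl⟩)
      rw [h0, TensorProduct.tmul_zero]
    | add y z hy hz =>
      have : (fun b => β (e b) • (y + z)) = (fun b => β (e b) • y) + fun b => β (e b) • z := by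
        ext b; simp
      rw [this, map_add, map_add, hy, hz, add_zero]
  have hte : t ⊗ₜ[S] (e : X) = ∑ i, ∑ j, (TensorProduct.piRight S S T fun _ => M).symm
      (fun b => β i (e b) j • (γ i (Finsupp.single j 1) • x i)) := by
    simp only [← map_sum]
    rw [LinearEquiv.eq_symm_apply]
    ext b
    rw [TensorProduct.piRight_apply, TensorProduct.piRightHom_tmul, Finset.sum_apply]
    have h1 := h (1 ⊗ₜ e b)
    rw [TensorProduct.smul_tmul', smul_eq_mul, mul_one] at h1
    refine h1.trans (Finset.sum_congr rfl fun i _ => ?_)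
    rw [Finset.sum_apply, hβ', Finset.sum_smul]
    exact Finset.sum_congr rfl fun j _ => by rw [mul_smul, algebraMap_smul]
  change π (t ⊗ₜ (e : X)) = 0
  rw [hte, map_sum]
  refine Finset.sum_eq_zero fun i _ => ?_
  rw [map_sum]
  exact Finset.sum_eq_zero fun j _ => hπ (Finsupp.lapply j ∘ₗ β i) _

theorem mem_freeFactorIdeal_baseChange {T : Type*} [CommRing T] [Algebra S T]
    {M : Type*} [AddCommGroup M] [Module S M] {s : S} (hs : s ∈ freeFactorIdeal S M) :
    algebraMap S T s ∈ freeFactorIdeal T (T ⊗[S] M) := by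
  obtain ⟨κ, _, α, x, h⟩ := hs
  refine ⟨κ, inferInstance, fun i => (Algebra.TensorProduct.rid S T T).toLinearMap ∘ₗ
    (α i).baseChange T, fun i => 1 ⊗ₜ x i, fun z => ?_⟩
  induction z using TensorProduct.induction_on with
  | zero => simp
  | tmul a m =>
    rw [algebraMap_smul, TensorProduct.smul_tmul', TensorProduct.smul_tmul, h,
      TensorProduct.tmul_sum]
    refine Finset.sum_congr rfl fun i _ => ?_
    have h1 : ((Algebra.TensorProduct.rid S T T).toLinearMap ∘ₗ (α i).baseChange T) (a ⊗ₜ m) =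
        α i m • a := by
      rw [LinearMap.comp_apply, LinearMap.baseChange_tmul]
      exact Algebra.TensorProduct.rid_tmul (R := S) T (α i m) a
    rw [h1, TensorProduct.smul_tmul', smul_eq_mul, mul_one, TensorProduct.smul_tmul]
  | add y z hy hz => simp [smul_add, hy, hz, add_smul, Finset.sum_add_distrib]

/-- If multiplication by a power of `a` factors through a free module, then `M[1/a]` is
projective. -/
theorem projective_of_pow_mem_freeFactorIdeal {M : Type*} [AddCommGroup M] [Module S M] {a : S}
    {n : ℕ} (h : a ^ n ∈ freeFactorIdeal S M) :
    Module.Projective (Localization.Away a) (LocalizedModule (Submonoid.powers a) M) := by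
  let T := Localization.Away a
  have e := (IsLocalizedModule.isBaseChange (Submonoid.powers a) T
    (LocalizedModule.mkLinearMap (Submonoid.powers a) M)).equiv
  suffices Module.Projective T (T ⊗[S] M) from Module.Projective.of_equiv e
  obtain ⟨κ, _, α, x, h⟩ := mem_freeFactorIdeal_baseChange (T := T) h
  have hu : IsUnit (algebraMap S T (a ^ n)) := by
    rw [map_pow]; exact (IsLocalization.Away.algebraMap_isUnit a).pow n
  obtain ⟨w, hw⟩ := hu.exists_left_inv
  refine Module.Projective.of_split (M := κ → T) (LinearMap.pi α)
    (w • Fintype.linearCombination T x) (LinearMap.ext fun z => ?_)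
  rw [LinearMap.comp_apply, LinearMap.smul_apply, Fintype.linearCombination_apply]
  simp only [LinearMap.pi_apply]
  rw [← h, ← mul_smul, hw, one_smul, LinearMap.id_apply]

end

section

variable {S : Type u} [CommRing S] {f : S →+* S} {M : Type v} [AddCommGroup M] [Module S M]

theorem linearization_smul (φM : M →ₛₗ[f] M) (s : S) (z : Twist f ⊗[S] M) :
    linearization φM (Twist.mk f s • z) = s • linearization φM z := by
  induction z using TensorProduct.induction_on with
  | zero => simp
  | tmul a m =>
    rw [TensorProduct.smul_tmul']
    change linearization φM (Twist.mk f (s * (Twist.mk f).symm a) ⊗ₜ m) =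
      s • linearization φM (Twist.mk f ((Twist.mk f).symm a) ⊗ₜ m)
    rw [linearization_tmul, linearization_tmul, mul_smul]
  | add y z hy hz => rw [smul_add, map_add, map_add, smul_add, hy, hz]

/-- For `M` of finite height, `1 ⊗ φ` is an isogeny up to powers of `E`, so the ideal of `M` and its
image under `f` agree up to powers of `E`. -/
theorem HeightLE.freeFactorIdeal_mul [IsNoetherianRing S] [Module.Finite S M] (hf : f.Flat)
    {E : S} {r : ℕ} {φM : M →ₛₗ[f] M} (h : HeightLE E r φM) {s : S} :
    (s ∈ freeFactorIdeal S M → E ^ r * s ∈ (freeFactorIdeal S M).map f) ∧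
    (s ∈ freeFactorIdeal S M → E ^ r * f s ∈ freeFactorIdeal S M) := by
  obtain ⟨hinj, hsurj⟩ := h
  let _ : Module (Twist f) M := inferInstanceAs (Module S M)
  let lin : Twist f ⊗[S] M →ₗ[Twist f] M :=
    { toFun := linearization φM
      map_add' := map_add _
      map_smul' := fun s z => linearization_smul φM ((Twist.mk f).symm s) z }
  choose g hg using hsurj
  have hlin : Function.Injective lin := hinj
  have hg' : ∀ m, lin (g m) = Twist.mk f (E ^ r) • m := hg
  let g' : M →ₗ[Twist f] Twist f ⊗[S] M :=
    { toFun := g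
      map_add' := fun x y => hlin (by rw [map_add, hg', hg', hg', smul_add])
      map_smul' := fun t x => hlin (by
        rw [RingHom.id_apply, map_smul, hg', hg', smul_comm]) }
  have hgl : ∀ z, g' (lin z) = Twist.mk f (E ^ r) • z := fun z => hlin (by
    rw [map_smul]; exact hg' _)
  have : Module.Flat S (Twist f) := hf
  have hMT : ∀ s : S, s ∈ freeFactorIdeal S M ↔ Twist.mk f s ∈ freeFactorIdeal (Twist f) M :=
    fun s => Iff.rfl
  refine ⟨fun hs => ?_, fun hs => ?_⟩
  · have h1 : Twist.mk f (E ^ r) * Twist.mk f s ∈ freeFactorIdeal (Twist f) (Twist f ⊗[S] M) :=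
      mul_mem_freeFactorIdeal_of_comp (S := Twist f) (A := M) g' lin hgl ((hMT s).1 hs)
    exact mem_map_freeFactorIdeal (T := Twist f) h1
  · have h1 : Twist.mk f (E ^ r) * algebraMap S (Twist f) s ∈ freeFactorIdeal (Twist f) M :=
      mul_mem_freeFactorIdeal_of_comp (S := Twist f) (B := M) lin g' hg'
        (mem_freeFactorIdeal_baseChange (T := Twist f) hs)
    exact h1

end

end RelBK

/-! ### Asymptotic bounds modulo an ideal -/

namespace RelBK

section

variable {S : Type*} [CommRing S]

/-- `x ^ (b N + C) ∈ I + (y ^ (a N))` for all `N` and some constant `C`: on the zero locus of `I`,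
the valuations satisfy `b v(x) ≥ a v(y)`. -/
def Bound (I : Ideal S) (x y : S) (b a : ℕ) : Prop :=
  ∃ C, ∀ N, x ^ (b * N + C) ∈ I ⊔ Ideal.span {y ^ (a * N)}

theorem sup_span_pow_anti (I : Ideal S) (y : S) {m n : ℕ} (h : m ≤ n) :
    I ⊔ Ideal.span {y ^ n} ≤ I ⊔ Ideal.span {y ^ m} :=
  sup_le_sup_left ((Ideal.span_singleton_le_span_singleton).2 (pow_dvd_pow y h)) I

theorem pow_mem_sup_span_pow {I : Ideal S} {x y : S} (h : x ∈ I ⊔ Ideal.span {y}) (n : ℕ) :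
    x ^ n ∈ I ⊔ Ideal.span {y ^ n} := by
  obtain ⟨i, hi, j, hj, hij⟩ := Submodule.mem_sup.1 h
  obtain ⟨j, rfl⟩ := Ideal.mem_span_singleton.1 hj
  have h1 : (i + y * j) ^ n - (y * j) ^ n ∈ I := by
    obtain ⟨c, hc⟩ := sub_dvd_pow_sub_pow (i + y * j) (y * j) n
    rw [hc, add_sub_cancel_right]
    exact Ideal.mul_mem_right _ _ hi
  rw [← hij, ← sub_add_cancel ((i + y * j) ^ n) ((y * j) ^ n)]
  refine add_mem (Ideal.mem_sup_left h1) (Ideal.mem_sup_right ?_)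
  rw [mul_pow]
  exact Ideal.mul_mem_right _ _ (Ideal.mem_span_singleton_self _)

theorem Bound.mono {I : Ideal S} {x y : S} {b a b' a' : ℕ} (h : Bound I x y b a) (hb : b ≤ b')
    (ha : a' ≤ a) : Bound I x y b' a' := by
  obtain ⟨C, hC⟩ := h
  refine ⟨C, fun N => ?_⟩
  refine Ideal.mem_of_dvd _ (pow_dvd_pow x ?_)
    (sup_span_pow_anti I y (Nat.mul_le_mul_right N ha) (hC N))
  have := Nat.mul_le_mul_right N hb
  omega

theorem bound_of_mem {I : Ideal S} {x y : S} {b a : ℕ} (h : x ^ b ∈ I ⊔ Ideal.span {y ^ a}) :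
    Bound I x y b a :=
  ⟨0, fun N => by simpa [pow_mul] using pow_mem_sup_span_pow h N⟩

/-- If `E ^ n I' ⊆ I`, then the zero locus of `I` lies in the union of those of `I'` and `E`. So a
bound for `I'` is a bound for `I` if it is weaker than the one satisfied on the zero locus of `E`,
which is `s v(x) ≥ t v(y)` by `hxy`. -/
theorem Bound.of_mul_mem {I I' : Ideal S} {x y E : S} {n s t b a : ℕ}
    (hE : ∀ i ∈ I', E ^ n * i ∈ I)
    (hxy : ∀ k, x ^ (s * (k + n)) ∈ Ideal.span {E ^ n} ⊔ Ideal.span {y ^ (t * k)})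
    (hI : ∃ D, x ^ D ∈ I ⊔ Ideal.span {y}) (hab : s * a < t * b) (h : Bound I' x y b a) :
    Bound I x y b a := by
  obtain ⟨C, hC⟩ := h
  -- on the zero locus of `E`, `x ^ (b M)` is divisible by `y ^ (t k) = y ^ (a M)`
  obtain ⟨M, k, hM, hk, hsk⟩ : ∃ M k, 0 < M ∧ t * k = a * M ∧ s * (k + n) ≤ b * M := by
    refine ⟨t * (s * n + 1), a * (s * n + 1), ?_, by ring, ?_⟩
    · exact Nat.mul_pos (Nat.pos_of_ne_zero (by rintro rfl; omega)) (Nat.succ_pos _)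
    · have h1 : (s * a + 1) * (s * n + 1) ≤ t * b * (s * n + 1) := Nat.mul_le_mul_right _ hab
      have h2 : s * (a * (s * n + 1) + n) = s * a * (s * n + 1) + s * n := by ring
      have h3 : b * (t * (s * n + 1)) = t * b * (s * n + 1) := by ring
      rw [h2, h3]
      have h4 : (s * a + 1) * (s * n + 1) = s * a * (s * n + 1) + (s * n + 1) := by
        rw [add_mul, one_mul]
      omega
  obtain ⟨D₀, hD₀⟩ := hI
  have hD : x ^ (D₀ * (a * M)) ∈ I ⊔ Ideal.span {y ^ (a * M)} := by
    rw [pow_mul x]; exact pow_mem_sup_span_pow hD₀ _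
  refine ⟨s * (k + n) + C + D₀ * (a * M), fun N => ?_⟩
  induction N using Nat.strong_induction_on with
  | _ N ih =>
    by_cases hN : N < M
    · refine Ideal.mem_of_dvd _ (pow_dvd_pow x ?_)
        (sup_span_pow_anti I y (Nat.mul_le_mul_left a hN.le) hD)
      omega
    · obtain ⟨L, rfl⟩ := Nat.exists_eq_add_of_le (not_lt.1 hN)
      have hsplit : x ^ (b * (M + L) + (s * (k + n) + C + D₀ * (a * M))) =
          x ^ (s * (k + n)) * (x ^ (b * (M + L) + C) * x ^ (D₀ * (a * M))) := by
        rw [← pow_add, ← pow_add]; congr 1; ring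
      obtain ⟨z, hz, w, hw, hzw⟩ := Submodule.mem_sup.1 (hxy k)
      obtain ⟨z, rfl⟩ := Ideal.mem_span_singleton.1 hz
      obtain ⟨w, rfl⟩ := Ideal.mem_span_singleton.1 hw
      rw [hsplit, ← hzw, add_mul]
      refine add_mem ?_ ?_
      · obtain ⟨i, hi, j, hj, hij⟩ := Submodule.mem_sup.1 (hC (M + L))
        rw [← hij]
        have : E ^ n * z * ((i + j) * x ^ (D₀ * (a * M))) =
            E ^ n * i * (z * x ^ (D₀ * (a * M))) + j * (E ^ n * z * x ^ (D₀ * (a * M))) := by ring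
        rw [this]
        exact add_mem (Ideal.mul_mem_right _ _ (Ideal.mem_sup_left (hE i hi)))
          (Ideal.mul_mem_right _ _ (Ideal.mem_sup_right hj))
      · obtain ⟨c, hc⟩ : x ^ (b * L + (s * (k + n) + C + D₀ * (a * M))) ∣
            x ^ (b * (M + L) + C) * x ^ (D₀ * (a * M)) := by
          rw [← pow_add]
          refine pow_dvd_pow x ?_
          rw [mul_add b]
          omega
        obtain ⟨i, hi, j, hj, hij⟩ := Submodule.mem_sup.1 (ih L (by omega))
        obtain ⟨j, rfl⟩ := Ideal.mem_span_singleton.1 hj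
        rw [hc, ← hij, hk]
        -- the bound for `L` multiplied by `y ^ (a M)` is the one for `M + L`
        have : y ^ (a * M) * w * ((i + y ^ (a * L) * j) * c) =
            i * (y ^ (a * M) * w * c) + y ^ (a * (M + L)) * (j * w * c) := by ring
        rw [this]
        exact add_mem (Ideal.mul_mem_right _ _ (Ideal.mem_sup_left hi))
          (Ideal.mul_mem_right _ _ (Ideal.mem_sup_right (Ideal.mem_span_singleton_self _)))

/-- Contradictory bounds on `x` and `y` force a power of `y` into `I`. -/
theorem exists_pow_mem_of_bound {I : Ideal S} {x y : S} {b a b' a' : ℕ} (hb : 0 < b) (ha : 0 < a)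
    (ha' : 0 < a') (h : Bound I x y b a) (h' : Bound I y x b' a') (hlt : b' * b < a * a')
    (hy : y ∈ Ideal.jacobson (⊥ : Ideal S)) : ∃ n, y ^ n ∈ I := by
  obtain ⟨C, hC⟩ := h
  obtain ⟨C', hC'⟩ := h'
  -- composing the bounds bounds `y` by a higher power of itself, for exponents this large
  let t := a * C + C' + 1
  have hCt : C ≤ a' * t := by
    have h1 : C ≤ a * C := Nat.le_mul_of_pos_left C ha
    have h2 : t ≤ a' * t := Nat.le_mul_of_pos_left t ha'
    omega
  obtain ⟨N, hN⟩ := Nat.exists_eq_add_of_le hCt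
  have hx := hC N
  have hy' := hC' (b * t)
  have hle1 : b * N + C ≤ a' * (b * t) := by
    have h1 : C ≤ b * C := Nat.le_mul_of_pos_left C hb
    have h2 : a' * (b * t) = b * C + b * N := by rw [← mul_add, ← hN]; ring
    omega
  have hle2 : b' * (b * t) + C' + 1 ≤ a * N := by
    have h1 : (b' * b + 1) * t ≤ a * a' * t := Nat.mul_le_mul_right t hlt
    have h2 : a * a' * t = a * C + a * N := by rw [← mul_add, ← hN]; ring
    have h3 : (b' * b + 1) * t = b' * (b * t) + t := by ring
    omega
  refine ⟨b' * (b * t) + C', ?_⟩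
  have h1 : x ^ (a' * (b * t)) ∈ I ⊔ Ideal.span {y ^ (b' * (b * t) + C' + 1)} :=
    Ideal.mem_of_dvd _ (pow_dvd_pow x hle1) (sup_span_pow_anti I y hle2 hx)
  have h2 : y ^ (b' * (b * t) + C') ∈ I ⊔ Ideal.span {y ^ (b' * (b * t) + C' + 1)} :=
    sup_le le_sup_left ((Ideal.span_singleton_le_iff_mem _).2 h1) hy'
  obtain ⟨i, hi, j, hj, hij⟩ := Submodule.mem_sup.1 h2
  obtain ⟨j, rfl⟩ := Ideal.mem_span_singleton.1 hj
  obtain ⟨w, hw⟩ := (Ideal.mem_jacobson_bot.1 hy (-j)).exists_right_inv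
  have : y ^ (b' * (b * t) + C') = i * w := by
    have h3 : i = y ^ (b' * (b * t) + C') * (y * -j + 1) := by
      rw [eq_sub_of_add_eq hij]; ring
    rw [h3, mul_assoc, hw, mul_one]
  rw [this]
  exact Ideal.mul_mem_right _ _ hi

end

end RelBK

/-! ### Ideals that agree with their Frobenius pullback -/

namespace RelBK

section

variable {C T : Type*} [CommRing C] [CommRing T]

/-- For flat `f : C → T`, if `a` is regular on `C / I` then `f a` is regular on `T / I T`. -/
theorem mem_map_of_mul_mem_map {f : C →+* T} (hf : f.Flat) {I : Ideal C} {a : C}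
    (hI : ∀ x, a * x ∈ I → x ∈ I) {x : T} (hx : f a * x ∈ I.map f) : x ∈ I.map f := by
  obtain ⟨κ, _, g, t, hg, hgt⟩ := exists_sum_of_mem_map hx
  obtain ⟨μ, _, A, y, h1, h2⟩ := flat_iff_liftsRel_bot.1 hf (Option κ)
    (fun i => i.elim a fun k => -g k) (fun i => i.elim x t) (by
      simp only [Fintype.sum_option, Option.elim]
      rw [hgt]
      simp)
  have h3 := h1 none
  simp only [Option.elim] at h3
  rw [h3]
  refine sum_mem_map fun j => hI _ ?_
  have h4 := h2 j
  simp only [Fintype.sum_option, Option.elim, Ideal.mem_bot, mul_neg, Finset.sum_neg_distrib,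
    add_neg_eq_zero] at h4
  rw [mul_comm, h4]
  exact sum_mem fun k _ => Ideal.mul_mem_left _ _ (hg k)

/-- A flat Frobenius lift fixes the maximal ideals, hence is faithfully flat. -/
theorem mem_of_apply_mem_map {φ : C →+* C} (hf : φ.Flat) {p : ℕ} {Q : Ideal C}
    (hQ : Q ≤ Ideal.jacobson ⊥) (hp : p ≠ 0) (hφ : ∀ x, φ x - x ^ p ∈ Q) {I : Ideal C} {x : C}
    (hx : φ x ∈ I.map φ) : x ∈ I := by
  have : Module.Flat C (Twist φ) := hf
  have : Module.FaithfullyFlat C (Twist φ) := by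
    refine ⟨fun m hm h => hm.ne_top ?_⟩
    have hle : m.map φ ≤ m := by
      rw [Ideal.map_le_iff_le_comap]
      intro x hx
      have h1 : φ x - x ^ p ∈ m := Ideal.mem_sInf.1 (hQ (hφ x)) ⟨bot_le, hm⟩
      rw [Ideal.mem_comap, ← sub_add_cancel (φ x) (x ^ p)]
      exact add_mem h1 (Ideal.pow_mem_of_mem _ hx _ (Nat.pos_of_ne_zero hp))
    have h2 : m.map (algebraMap C (Twist φ)) = ⊤ := by
      rw [Ideal.smul_top_eq_map] at h
      exact (Submodule.restrictScalars_eq_top_iff C _ _).1 h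
    have h3 : m.map φ = ⊤ := h2
    rwa [h3, top_le_iff] at hle
  have h1 : x ∈ (I.map (algebraMap C (Twist φ))).comap (algebraMap C (Twist φ)) := hx
  rwa [Ideal.comap_map_eq_self_of_faithfullyFlat] at h1

/-- Cayley–Hamilton in a domain: if `w J ⊆ J ^ 2` then a power of `w` lies in `J`. -/
theorem exists_pow_mem_of_mul_mem_mul {B : Type*} [CommRing B] [IsDomain B] [IsNoetherianRing B]
    {J : Ideal B} (hJ : J ≠ ⊥) {w : B} (h : ∀ x ∈ J, w * x ∈ J * J) : ∃ m, w ^ m ∈ J := by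
  obtain ⟨P, hP, -, hc, h0⟩ :=
    LinearMap.exists_monic_and_natDegree_eq_and_coeff_mem_pow_and_aeval_eq_zero B
      (algebraMap B (Module.End B J) w) J (by
        rintro _ ⟨x, rfl⟩
        rw [Submodule.mem_smul_top_iff]
        exact h x x.2)
  obtain ⟨x, hx, hx0⟩ := Submodule.exists_mem_ne_zero_of_ne_bot hJ
  rw [Polynomial.aeval_algebraMap_apply] at h0
  have h1 : P.eval w * x = 0 := by
    have := congrArg Subtype.val (LinearMap.congr_fun h0 ⟨x, hx⟩)
    simpa [Module.algebraMap_end_apply] using this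
  have h2 : P.eval w = 0 := (mul_eq_zero.1 h1).resolve_right hx0
  refine ⟨P.natDegree, ?_⟩
  rw [Polynomial.eval_eq_sum_range, Finset.sum_range_succ, hP.coeff_natDegree, one_mul] at h2
  rw [eq_neg_of_add_eq_zero_right h2]
  refine neg_mem (sum_mem fun k hk => Ideal.mul_mem_right _ _ ?_)
  exact Ideal.pow_le_self (Nat.sub_ne_zero_of_lt (Finset.mem_range.1 hk)) (hc k)

/-- Modulo `p` the pullback of `I` by `φ` is generated by `p`-th powers, so it lies in the square of
`I`; if it contains `w ^ n I`, then a power of `w` lies in `I + (p)`. -/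
theorem exists_pow_mem_sup_of_pow_mul_mem_map [IsDomain C] [IsNoetherianRing C] {p : ℕ}
    (hp : 2 ≤ p) (hprime : (Ideal.span {(p : C)}).IsPrime) {φ : C →+* C}
    (hφ : ∀ x, φ x - x ^ p ∈ Ideal.span {(p : C)}) {I : Ideal C} (hI : I ≠ ⊥)
    (hsat : ∀ x, (p : C) * x ∈ I → x ∈ I) {w : C} {n : ℕ} (h : ∀ x ∈ I, w ^ n * x ∈ I.map φ) :
    ∃ m, w ^ m ∈ I ⊔ Ideal.span {(p : C)} := by
  let q := Ideal.Quotient.mk (Ideal.span {(p : C)})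
  have hJ : I.map q ≠ ⊥ := by
    intro h0
    have hle : I ≤ Ideal.span {(p : C)} := by
      rwa [Ideal.map_eq_bot_iff_le_ker, Ideal.mk_ker] at h0
    -- a saturated ideal contained in `(p)` equals `p I`, hence is infinitely divisible by `p`
    have hpow : ∀ m, I ≤ Ideal.span {(p : C)} ^ m := by
      intro m
      induction m with
      | zero => simp
      | succ m ih =>
        intro x hx
        obtain ⟨y, rfl⟩ := Ideal.mem_span_singleton.1 (hle hx)
        rw [pow_succ']
        exact Ideal.mul_mem_mul (Ideal.mem_span_singleton_self _) (ih (hsat y hx))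
    refine hI (le_bot_iff.1 ?_)
    rw [← Ideal.iInf_pow_eq_bot_of_isDomain _ hprime.ne_top]
    exact le_iInf hpow
  have hφJ : ∀ y ∈ I.map φ, q y ∈ I.map q * I.map q := by
    suffices I.map φ ≤ (I.map q * I.map q).comap q from fun y hy => this hy
    rw [Ideal.map_le_iff_le_comap]
    intro x hx
    have h1 : q (φ x) = q x ^ p := by
      rw [← map_pow]
      exact (Ideal.Quotient.mk_eq_mk_iff_sub_mem _ _).2 (hφ x)
    rw [Ideal.mem_comap, Ideal.mem_comap, h1, ← pow_two]
    exact Ideal.pow_le_pow_right hp (Ideal.pow_mem_pow (Ideal.mem_map_of_mem q hx) p)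
  obtain ⟨m, hm⟩ := exists_pow_mem_of_mul_mem_mul (w := q (w ^ n)) hJ (fun x hx => by
    obtain ⟨y, hy, rfl⟩ := (Ideal.mem_map_iff_of_surjective q Ideal.Quotient.mk_surjective).1 hx
    rw [← map_mul]
    exact hφJ _ (h y hy))
  refine ⟨n * m, ?_⟩
  rw [← map_pow, ← pow_mul] at hm
  have h2 : w ^ (n * m) ∈ (I.map q).comap q := hm
  rwa [Ideal.comap_map_of_surjective' q Ideal.Quotient.mk_surjective, Ideal.mk_ker] at h2

/-- The saturation `(I : a ^ ∞)`: the elements that some power of `a` multiplies into `I`. -/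
def saturation (I : Ideal C) (a : C) : Ideal C where
  carrier := {x | ∃ k, a ^ k * x ∈ I}
  zero_mem' := ⟨0, by simp⟩
  add_mem' := by
    rintro x y ⟨k, hk⟩ ⟨l, hl⟩
    refine ⟨k + l, ?_⟩
    have : a ^ (k + l) * (x + y) = a ^ l * (a ^ k * x) + a ^ k * (a ^ l * y) := by ring
    rw [this]
    exact add_mem (Ideal.mul_mem_left _ _ hk) (Ideal.mul_mem_left _ _ hl)
  smul_mem' := by
    rintro c x ⟨k, hk⟩
    refine ⟨k, ?_⟩
    rw [smul_eq_mul, mul_left_comm]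
    exact Ideal.mul_mem_left _ _ hk

theorem le_saturation (I : Ideal C) (a : C) : I ≤ saturation I a := fun x hx => ⟨0, by simpa⟩

theorem mem_saturation_of_mul_mem {I : Ideal C} {a x : C} (h : a * x ∈ saturation I a) :
    x ∈ saturation I a := by
  obtain ⟨k, hk⟩ := h
  exact ⟨k + 1, by rwa [pow_succ, mul_assoc]⟩

/-- Pullback by a flat map preserves `p`-saturated ideals, so an inclusion `w I ⊆ I.map φ` passes to
the `p`-saturations. -/
theorem mul_mem_map_saturation {φ : C →+* C} (hφ : φ.Flat) {I : Ideal C} {p : ℕ} {w : C}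
    (h : ∀ x ∈ I, w * x ∈ I.map φ) {x : C} (hx : x ∈ saturation I (p : C)) :
    w * x ∈ (saturation I (p : C)).map φ := by
  obtain ⟨k, hk⟩ := hx
  refine mem_map_of_mul_mem_map hφ (a := (p : C) ^ k) (fun y hy => ?_) ?_
  · obtain ⟨l, hl⟩ := hy
    exact ⟨l + k, by rwa [pow_add, mul_assoc]⟩
  · rw [map_pow, map_natCast, mul_left_comm]
    exact Ideal.map_mono (le_saturation I _) (h _ hk)

end

end RelBK

/-! ### Power series over a base ring -/

namespace RelBK

open PowerSeries

section

variable {R : Type*} [CommRing R]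

theorem ker_map_mk (a : R) :
    RingHom.ker (PowerSeries.map (Ideal.Quotient.mk (Ideal.span {a}))) =
      Ideal.span {(C a : R⟦X⟧)} := by
  refine le_antisymm (fun f hf => ?_) ?_
  · have h1 : ∀ n, ∃ c, coeff n f = a * c := fun n => by
      have := congrArg (coeff n) (RingHom.mem_ker.1 hf)
      rw [coeff_map, map_zero, Ideal.Quotient.eq_zero_iff_mem, Ideal.mem_span_singleton] at this
      exact this
    choose c hc using h1
    refine Ideal.mem_span_singleton.2 ⟨PowerSeries.mk c, ?_⟩
    ext n
    rw [coeff_C_mul, coeff_mk, hc]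
  · rw [Ideal.span_singleton_le_iff_mem, RingHom.mem_ker, map_C,
      Ideal.Quotient.eq_zero_iff_mem.2 (Ideal.mem_span_singleton_self a), map_zero]

theorem C_natCast (n : ℕ) : (C (n : R) : R⟦X⟧) = n := map_natCast _ n

theorem isPrime_span_natCast {p : ℕ} (h : IsDomain (R ⧸ Ideal.span {(p : R)})) :
    (Ideal.span {(p : R⟦X⟧)}).IsPrime := by
  rw [← C_natCast, ← ker_map_mk]
  exact RingHom.ker_isPrime _

theorem mem_jacobson_bot_of_constantCoeff {f : R⟦X⟧}
    (h : constantCoeff f ∈ Ideal.jacobson (⊥ : Ideal R)) : f ∈ Ideal.jacobson (⊥ : Ideal R⟦X⟧) := by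
  rw [Ideal.mem_jacobson_bot] at h ⊢
  intro y
  rw [isUnit_iff_constantCoeff, map_add, map_mul, map_one]
  exact h _

/-- The extension of `φ` to `R⟦u⟧` is again a lift of the Frobenius. -/
theorem frobS_sub_pow_mem {p : ℕ} [hp : Fact p.Prime] {φ : R →+* R}
    (hφ : ∀ x, φ x - x ^ p ∈ Ideal.span {(p : R)}) (hnt : Nontrivial (R ⧸ Ideal.span {(p : R)}))
    (f : R⟦X⟧) :
    frobS p φ f - f ^ p ∈ Ideal.span {(p : R⟦X⟧)} := by
  let q := Ideal.Quotient.mk (Ideal.span {(p : R)})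
  have hp0 : ((p : ℕ) : R ⧸ Ideal.span {(p : R)}) = 0 := natCast_quotient_eq_zero p R
  have : CharP (R ⧸ Ideal.span {(p : R)}) p := (CharP.charP_iff_prime_eq_zero hp.out).2 hp0
  have := hp.out.ne_zero
  rw [← C_natCast, ← ker_map_mk, RingHom.mem_ker, map_sub, map_pow, frobS_apply, map_expand,
    sub_eq_zero]
  have h1 : PowerSeries.map q (PowerSeries.map φ f) =
      PowerSeries.map (frobenius _ p) (PowerSeries.map q f) := by
    ext n
    simp only [coeff_map, frobenius_def, ← map_pow]
    exact (Ideal.Quotient.mk_eq_mk_iff_sub_mem _ _).2 (hφ _)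
  rw [h1, ← map_expand]
  exact MvPowerSeries.map_frobenius_expand p hp.out.ne_zero

end

end RelBK

/-! ### Powers of `p` in an ideal that agrees with its Frobenius pullback -/

namespace RelBK

open PowerSeries

section

variable {R : Type*} [CommRing R]

/-- The order of vanishing along `u = 0` of the elements of `I.map φ` is at least `p` times that of
the elements of `I`. -/
theorem map_frobS_le_span_X_pow {p : ℕ} [Fact p.Prime] {φ : R →+* R} {I : Ideal R⟦X⟧} {m : ℕ}
    (h : I ≤ Ideal.span {X ^ m}) : I.map (frobS p φ) ≤ Ideal.span {X ^ (p * m)} := by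
  rw [Ideal.map_le_iff_le_comap]
  intro x hx
  obtain ⟨y, rfl⟩ := Ideal.mem_span_singleton.1 (h hx)
  rw [Ideal.mem_comap, map_mul, map_pow, frobS_X, ← pow_mul]
  exact Ideal.mul_mem_right _ _ (Ideal.mem_span_singleton_self _)

/-- If all elements of `I` vanished on the locus `u = 0`, then the lower bounds on their order of
vanishing, which multiplication by `E` does not change, could be multiplied by `p` again and
again. -/
theorem exists_constantCoeff_ne_zero [IsDomain R] {p : ℕ} [hp : Fact p.Prime] {φ : R →+* R}
    {I : Ideal R⟦X⟧} (hI : I ≠ ⊥) {E : R⟦X⟧} {n : ℕ} (hE : constantCoeff E ≠ 0)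
    (h : ∀ x ∈ I, E ^ n * x ∈ I.map (frobS p φ)) : ∃ f ∈ I, constantCoeff f ≠ 0 := by
  by_contra! hc
  have hpow : ∀ m, I ≤ Ideal.span {X ^ (m + 1)} := by
    intro m
    induction m with
    | zero =>
      intro x hx
      rw [zero_add, pow_one, Ideal.mem_span_singleton, X_dvd_iff]
      exact hc x hx
    | succ m ih =>
      intro x hx
      have h1 := Ideal.mem_span_singleton.1 (map_frobS_le_span_X_pow ih (h x hx))
      have h2 : X ^ (p * (m + 1)) ∣ x := by
        refine X_prime.pow_dvd_of_dvd_mul_left _ (fun hX => hE ?_) h1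
        exact X_dvd_iff.1 (X_prime.dvd_of_dvd_pow hX)
      refine Ideal.mem_span_singleton.2 ((pow_dvd_pow X ?_).trans h2)
      have := Nat.mul_le_mul_right (m + 1) hp.out.two_le
      omega
  refine hI (le_bot_iff.1 fun x hx => ?_)
  ext n
  exact X_pow_dvd_iff.1 (Ideal.mem_span_singleton.1 (hpow n hx)) n (Nat.lt_succ_self n)

/-- Restriction to `u = 0`: since `E(0)` is `p` times a unit, the `p`-saturation of the restriction
of `I` agrees with its Frobenius pullback and is the unit ideal. -/
theorem exists_natCast_pow_mem_sup_span_X [IsDomain R] [IsNoetherianRing R] {p : ℕ}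
    [hp : Fact p.Prime] {φ : R →+* R} (hφf : φ.Flat)
    (hφ : ∀ x, φ x - x ^ p ∈ Ideal.span {(p : R)}) (hp0 : (p : R) ≠ 0)
    (hprime : (Ideal.span {(p : R)}).IsPrime)
    (hjac : (p : R) ∈ Ideal.jacobson (⊥ : Ideal R)) {I : Ideal R⟦X⟧} (hI : I ≠ ⊥) {E : R⟦X⟧}
    {v : R} (hv : IsUnit v) (hE : constantCoeff E = p * v) {n : ℕ}
    (h : ∀ x ∈ I, E ^ n * x ∈ I.map (frobS p φ)) : ∃ m, (p : R⟦X⟧) ^ m ∈ I ⊔ Ideal.span {X} := by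
  have hsurj : Function.Surjective (constantCoeff (R := R)) := fun a => ⟨C a, constantCoeff_C a⟩
  obtain ⟨f, hf, hf0⟩ := exists_constantCoeff_ne_zero hI
    (by rw [hE]; exact mul_ne_zero hp0 hv.ne_zero) h
  let I₀ := I.map (constantCoeff (R := R))
  have h0 : ∀ x ∈ I₀, (p : R) ^ n * x ∈ I₀.map φ := by
    intro x hx
    obtain ⟨y, hy, rfl⟩ := (Ideal.mem_map_iff_of_surjective _ hsurj).1 hx
    have h1 := Ideal.mem_map_of_mem (constantCoeff (R := R)) (h y hy)
    have h2 : (constantCoeff (R := R)).comp (frobS p φ) = φ.comp constantCoeff :=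
      RingHom.ext fun f => constantCoeff_frobS φ f
    rw [Ideal.map_map, h2, ← Ideal.map_map, map_mul, map_pow, hE, mul_pow, mul_right_comm] at h1
    exact (Ideal.mul_unit_mem_iff_mem _ (hv.pow n)).1 h1
  have hs0 : ∀ x ∈ saturation I₀ (p : R), (1 : R) ^ 0 * x ∈ (saturation I₀ (p : R)).map φ := by
    intro x hx
    rw [pow_zero, one_mul]
    refine mem_map_of_mul_mem_map hφf (a := (p : R) ^ n) (fun y hy => ?_) ?_
    · obtain ⟨k, hk⟩ := hy
      exact ⟨k + n, by rwa [pow_add, mul_assoc]⟩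
    · rw [map_pow, map_natCast]
      exact mul_mem_map_saturation hφf h0 hx
  obtain ⟨m, hm⟩ := exists_pow_mem_sup_of_pow_mul_mem_map hp.out.two_le hprime hφ
    (I := saturation I₀ (p : R)) (fun hb => hf0 (by
      rw [← Ideal.mem_bot, ← hb]
      exact le_saturation _ _ (Ideal.mem_map_of_mem _ hf)))
    (fun x => mem_saturation_of_mul_mem) hs0
  rw [one_pow] at hm
  have htop : saturation I₀ (p : R) = ⊤ := by
    obtain ⟨i, hi, j, hj, hij⟩ := Submodule.mem_sup.1 hm
    obtain ⟨j, rfl⟩ := Ideal.mem_span_singleton.1 hj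
    refine Ideal.eq_top_of_isUnit_mem _ hi ?_
    have := Ideal.mem_jacobson_bot.1 hjac (-j)
    rwa [show (p : R) * -j + 1 = i by rw [← hij]; ring] at this
  obtain ⟨k, hk⟩ : (1 : R) ∈ saturation I₀ (p : R) := htop ▸ Submodule.mem_top
  obtain ⟨y, hy, hyk⟩ := (Ideal.mem_map_iff_of_surjective _ hsurj).1 hk
  refine ⟨k, ?_⟩
  rw [← sub_add_cancel ((p : R⟦X⟧) ^ k) y, add_comm]
  refine add_mem (Ideal.mem_sup_left hy) (Ideal.mem_sup_right ?_)
  rw [Ideal.mem_span_singleton, X_dvd_iff, map_sub, hyk, map_pow, map_natCast, mul_one, sub_self]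

end

section

variable {S : Type*} [CommRing S]

theorem pow_mem_span_sup_span {a b c : S} (h : a + b = c) (n k : ℕ) :
    c ^ (n + k) ∈ Ideal.span {a ^ n} ⊔ Ideal.span {b ^ k} := by
  rw [← h]
  exact Ideal.add_pow_mem_of_pow_mem_of_le (m := n) (n := k) _
    (Ideal.mem_sup_left (Ideal.mem_span_singleton_self _))
    (Ideal.mem_sup_right (Ideal.mem_span_singleton_self _)) (Nat.le_succ _)

theorem apply_mem_map_sup_span {φ : S →+* S} {I : Ideal S} {x y : S} (h : x ∈ I ⊔ Ideal.span {y}) :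
    φ x ∈ I.map φ ⊔ Ideal.span {φ y} := by
  have := Ideal.mem_map_of_mem φ h
  rwa [Ideal.map_sup, Ideal.map_span, Set.image_singleton] at this

theorem mul_mem_of_mem_map {φ : S →+* S} {I : Ideal S} {c : S} (h : ∀ i ∈ I, c * φ i ∈ I) {x : S}
    (hx : x ∈ I.map φ) : c * x ∈ I := by
  obtain ⟨κ, _, g, t, hg, rfl⟩ := exists_sum_of_mem_map hx
  rw [Finset.mul_sum]
  refine sum_mem fun k _ => ?_
  rw [← mul_assoc]
  exact Ideal.mul_mem_right _ _ (h _ (hg k))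

variable {φ : S →+* S} {p e n b a : ℕ} {I : Ideal S} {x y E : S}

/-- A bound for `I` that is weaker than the one on the zero locus of `E` also holds for the pullback
of `I` by `φ`. It descends along `φ`, and becomes `p` times stronger since `φ` maps `x` to `x ^ p`
and fixes `y`. -/
theorem Bound.descend (hx : φ x = x ^ p) (hy : φ y = y)
    (hpure : ∀ (J : Ideal S) (z : S), φ z ∈ J.map φ → z ∈ J)
    (hE : ∀ i ∈ I, E ^ n * i ∈ I.map φ)
    (hxy : ∀ k, x ^ (e * (k + n)) ∈ Ideal.span {E ^ n} ⊔ Ideal.span {y ^ (1 * k)})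
    (hI : ∃ D, x ^ D ∈ I ⊔ Ideal.span {y}) (hab : e * a < b) (h : Bound I x y b a) :
    Bound I x y b (p * a) := by
  obtain ⟨D, hD⟩ := hI
  obtain ⟨C, hC⟩ : Bound (I.map φ) x y b a := by
    refine Bound.of_mul_mem hE hxy ⟨p * D, ?_⟩ (by omega) h
    have := apply_mem_map_sup_span (φ := φ) hD
    rwa [map_pow, hx, hy, ← pow_mul] at this
  refine ⟨C, fun N => hpure _ _ ?_⟩
  rw [map_pow, hx, Ideal.map_sup, Ideal.map_span, Set.image_singleton, map_pow, hy, ← pow_mul]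
  rcases Nat.eq_zero_or_pos p with rfl | hp
  · simp
  refine Ideal.mem_of_dvd _ (pow_dvd_pow x ?_)
    (by simpa only [mul_left_comm a, mul_assoc] using hC (p * N))
  have := Nat.le_mul_of_pos_left C hp
  have h2 : p * (b * N + C) = b * (p * N) + p * C := by ring
  omega

/-- Applying `φ` to a bound for `I` gives a bound for the pullback of `I`, hence one for `I` if it is
weaker than the one on the zero locus of `E`. -/
theorem Bound.of_pullback (hx : φ x = x ^ p) (hy : φ y = y)
    (hE : ∀ i ∈ I, E ^ n * φ i ∈ I)
    (hxy : ∀ k, y ^ (1 * (k + n)) ∈ Ideal.span {E ^ n} ⊔ Ideal.span {x ^ (e * k)})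
    (hI : ∃ D, y ^ D ∈ I ⊔ Ideal.span {x}) (hab : p * a < e * b) (h : Bound I y x b a) :
    Bound I y x b (p * a) := by
  refine Bound.of_mul_mem (I' := I.map φ) (fun i hi => mul_mem_of_mem_map hE hi) hxy hI
    (by omega) ?_
  obtain ⟨C, hC⟩ := h
  refine ⟨C, fun N => ?_⟩
  have := apply_mem_map_sup_span (φ := φ) (hC N)
  rwa [map_pow, map_pow, hx, hy, ← pow_mul, ← mul_assoc] at this

end

section

variable {R : Type*} [CommRing R] [IsDomain R] [IsNoetherianRing R] {p : ℕ} [hp : Fact p.Prime]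
  {φ : R →+* R}

/-- An ideal `I` that agrees with its Frobenius pullback up to powers of `E` contains a power of `p`.
At a point of its zero locus with `p ≠ 0`, iterating `Bound.descend` shows that `e v(u)` is at least
about `p v(p)`, and iterating `Bound.of_pullback` that it is at most about `v(p)`. -/
theorem exists_natCast_pow_mem (hφf : φ.Flat)
    (hφ : ∀ x, φ x - x ^ p ∈ Ideal.span {(p : R)}) (hp0 : (p : R) ≠ 0)
    (hdom : IsDomain (R ⧸ Ideal.span {(p : R)}))
    (hjac : (p : R) ∈ Ideal.jacobson (⊥ : Ideal R)) {I : Ideal R⟦X⟧} (hI : I ≠ ⊥)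
    (hsat : ∀ x, (p : R⟦X⟧) * x ∈ I → x ∈ I)
    {E v : R⟦X⟧} {e n : ℕ} (he : 0 < e) (hv : IsUnit v) (hE : E = X ^ e + (p : R⟦X⟧) * v)
    (h : ∀ x ∈ I, E ^ n * x ∈ I.map (frobS p φ)) (h' : ∀ x ∈ I, E ^ n * frobS p φ x ∈ I) :
    ∃ m, (p : R⟦X⟧) ^ m ∈ I := by
  have hfl := flat_frobS (p := p) hφf
  have hnt : Nontrivial (R ⧸ Ideal.span {(p : R)}) := inferInstance
  have hprime : (Ideal.span {(p : R)}).IsPrime := (Ideal.Quotient.isDomain_iff_prime _).1 hdom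
  have hΦ := frobS_sub_pow_mem hφ hnt
  have hpj : (p : R⟦X⟧) ∈ Ideal.jacobson (⊥ : Ideal R⟦X⟧) :=
    mem_jacobson_bot_of_constantCoeff (by rwa [map_natCast])
  have hpure : ∀ (J : Ideal R⟦X⟧) (z : R⟦X⟧), frobS p φ z ∈ J.map (frobS p φ) → z ∈ J :=
    fun J z hz => mem_of_apply_mem_map hfl ((Ideal.span_singleton_le_iff_mem _).2 hpj)
      hp.out.ne_zero hΦ hz
  have hE0 : constantCoeff E = p * constantCoeff v := by
    rw [hE, map_add, map_pow, constantCoeff_X, zero_pow he.ne', zero_add, map_mul, map_natCast]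
  -- `u ^ c ∈ I + (p)` and `p ^ m ∈ I + (u)`
  obtain ⟨m, hm⟩ := exists_natCast_pow_mem_sup_span_X hφf hφ hp0 hprime hjac hI
    (hv.map constantCoeff) hE0 h
  obtain ⟨c, hc⟩ : ∃ c, (X : R⟦X⟧) ^ c ∈ I ⊔ Ideal.span {(p : R⟦X⟧)} := by
    obtain ⟨c, hc⟩ := exists_pow_mem_sup_of_pow_mul_mem_map hp.out.two_le
      (isPrime_span_natCast hdom) hΦ hI hsat h
    refine ⟨e * c, ?_⟩
    obtain ⟨z, hz⟩ := sub_dvd_pow_sub_pow E (X ^ e) c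
    rw [pow_mul, ← sub_sub_cancel (E ^ c) ((X ^ e) ^ c), hz, hE, add_sub_cancel_left, ← hE]
    exact sub_mem hc (Ideal.mem_sup_right (Ideal.mem_span_singleton.2 (by
      rw [mul_assoc]; exact dvd_mul_right _ _)))
  have hXE : ∀ k, (X : R⟦X⟧) ^ (e * (k + n)) ∈
      Ideal.span {E ^ n} ⊔ Ideal.span {(p : R⟦X⟧) ^ (1 * k)} := by
    intro k
    rw [pow_mul X, one_mul, add_comm k n]
    refine (sup_le_sup_left ?_ _ : (_ : Ideal R⟦X⟧) ≤ _)
      (pow_mem_span_sup_span (b := -((p : R⟦X⟧) * v))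
        (show E + -((p : R⟦X⟧) * v) = X ^ e by rw [hE]; ring) n k)
    rw [Ideal.span_singleton_le_span_singleton, neg_pow, mul_pow]
    exact Dvd.intro (v ^ k * (-1) ^ k) (by ring)
  obtain ⟨w, hw⟩ := hv.exists_right_inv
  have hpE : ∀ k, (p : R⟦X⟧) ^ (1 * (k + n)) ∈
      Ideal.span {E ^ n} ⊔ Ideal.span {(X : R⟦X⟧) ^ (e * k)} := by
    intro k
    rw [one_mul, add_comm k n, pow_mul X]
    refine (sup_le_sup ?_ ?_ : (_ : Ideal R⟦X⟧) ≤ _)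
      (pow_mem_span_sup_span (a := E * w) (b := X ^ e * -w)
        (show E * w + X ^ e * -w = (p : R⟦X⟧) by
          rw [hE]; linear_combination (p : R⟦X⟧) * hw) n k)
    all_goals
      rw [Ideal.span_singleton_le_span_singleton, mul_pow]
      exact dvd_mul_right _ _
  -- `J` is chosen such that both families of bounds start, and `p ^ J ≥ 3`
  obtain ⟨J, hJ⟩ : ∃ J, c + m * e + 3 ≤ p ^ J :=
    ⟨c + m * e + 3, (Nat.lt_pow_self hp.out.one_lt).le⟩
  have hcm : c ≤ e * p ^ J := (by omega : c ≤ p ^ J).trans (Nat.le_mul_of_pos_left _ he)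
  have hU : ∀ i ≤ J + 1, Bound I (X : R⟦X⟧) p (e * p ^ J + 1) (p ^ i) := by
    intro i hi
    induction i with
    | zero =>
      refine Bound.mono (b := c) (a := 1) (bound_of_mem ?_) (by omega) (by simp)
      rwa [pow_one]
    | succ i ih =>
      rw [pow_succ']
      refine Bound.descend (frobS_X φ) (map_natCast _ _) hpure h hXE ⟨c, hc⟩ ?_ (ih (by omega))
      exact Nat.lt_succ_of_le (Nat.mul_le_mul_left e (Nat.pow_le_pow_right hp.out.pos (by omega)))
  have hL : ∀ i ≤ J, Bound I (p : R⟦X⟧) X (p ^ J + 1) (p ^ i * e) := by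
    intro i hi
    induction i with
    | zero =>
      refine Bound.mono (b := m * e) (a := e) (bound_of_mem ?_) (by omega) (by simp)
      rw [pow_mul]
      exact pow_mem_sup_span_pow hm e
    | succ i ih =>
      rw [pow_succ', mul_assoc]
      refine Bound.of_pullback (frobS_X φ) (map_natCast _ _) h' hpE ⟨m, hm⟩ ?_ (ih (by omega))
      have h1 : p ^ (i + 1) ≤ p ^ J := Nat.pow_le_pow_right hp.out.pos hi
      rw [← mul_assoc, ← pow_succ', mul_comm]
      exact Nat.mul_lt_mul_of_pos_left (by omega) he
  refine exists_pow_mem_of_bound (Nat.add_one_pos _) (pow_pos hp.out.pos _)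
    (Nat.mul_pos (pow_pos hp.out.pos _) he) (hU (J + 1) le_rfl) (hL J le_rfl) ?_ hpj
  have h1 : 3 ≤ p ^ J := by omega
  have h2 := hp.out.two_le
  rw [pow_succ]
  generalize p ^ J = q at h1
  have h3 : q * 2 * (q * e) ≤ q * p * (q * e) := by gcongr
  have h4 : 3 * (q * e) ≤ q * (q * e) := by gcongr
  have h5 : q * 1 ≤ q * e := by gcongr; exact he
  have h6 : q * 2 * (q * e) = 2 * (q * (q * e)) := by ring
  have h7 : (q + 1) * (e * q + 1) = q * (q * e) + q * e + q + 1 := by ring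
  omega

end

end RelBK

/-! ### The minimal polynomial of a uniformizer -/

namespace RelBK

open Polynomial IsLocalRing

/-- An irreducible monic polynomial over a complete local ring whose constant coefficient is not a
unit is `X ^ e` modulo the maximal ideal: it is divisible by the distinguished polynomial of its
Weierstrass factorization. -/
theorem isDistinguishedAt_of_irreducible {A : Type*} [CommRing A] [IsDomain A] [IsLocalRing A]
    [IsAdicComplete (maximalIdeal A) A] {E : A[X]} (hE : E.Monic) (hirr : Irreducible E)
    (h0 : E.coeff 0 ∈ maximalIdeal A) : E.IsDistinguishedAt (maximalIdeal A) := by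
  have hne : (E : PowerSeries A).map (residue A) ≠ 0 := by
    rw [← Polynomial.polynomial_map_coe, Ne, Polynomial.coe_eq_zero_iff]
    exact (hE.map _).ne_zero
  obtain ⟨f, h, H⟩ := PowerSeries.exists_isWeierstrassFactorization hne
  have hf := H.isDistinguishedAt
  -- polynomial division of `E` by `f` is also the Weierstrass division, whose remainder is zero
  have hdiv : f ∣ E := by
    rw [← Polynomial.modByMonic_eq_zero_iff_dvd hf.monic]
    have horder : (((f : PowerSeries A).map (Ideal.Quotient.mk (maximalIdeal A))).order.toNat) =
        f.natDegree := by
      rw [← hf.coe_natDegree_eq_order_map (f : PowerSeries A) 1 (by simp) (mul_one _).symm]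
      rfl
    have hlt : (E %ₘ f).degree < f.natDegree := by
      rw [← Polynomial.degree_eq_natDegree hf.monic.ne_zero]
      exact Polynomial.degree_modByMonic_lt E hf.monic
    refine (hf.isWeierstrassDivisorAt'.eq_of_mul_add_eq_mul_add (q := (E /ₘ f : A[X])) (q' := h)
      (r' := 0) (by rwa [horder]) (by rw [horder, degree_zero]; exact WithBot.bot_lt_coe _) ?_).2
    rw [Polynomial.coe_zero, add_zero, ← H.eq_mul, ← Polynomial.coe_mul, ← Polynomial.coe_add,
      add_comm, Polynomial.modByMonic_add_div]
  have hfu : ¬ IsUnit f := by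
    intro hu
    have h1 : f = 1 := hf.monic.eq_one_of_isUnit hu
    have h2 := congrArg PowerSeries.constantCoeff H.eq_mul
    rw [h1, Polynomial.coe_one, one_mul, Polynomial.constantCoeff_coe] at h2
    rw [mem_maximalIdeal, h2] at h0
    exact h0 (H.isUnit.map _)
  obtain ⟨c, hc⟩ := hdiv
  have hcu := (hirr.isUnit_or_isUnit hc).resolve_left hfu
  have h1 : c = 1 := (hf.monic.of_mul_monic_left (hc ▸ hE)).eq_one_of_isUnit hcu
  rwa [hc, h1, mul_one]

theorem exists_eq_X_pow_add_C_mul {A : Type*} [CommRing A] {a : A} {E : A[X]}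
    (h : E.IsDistinguishedAt (Ideal.span {a})) : ∃ f, E = X ^ E.natDegree + C a * f := by
  have h1 : E - X ^ E.natDegree ∈ (Ideal.span {a}).map C := by
    rw [← Ideal.mk_ker (I := Ideal.span {a}), ← Polynomial.ker_mapRingHom, RingHom.mem_ker, map_sub,
      coe_mapRingHom, h.map_eq_X_pow, Polynomial.map_pow, map_X, sub_self]
  rw [Ideal.map_span, Set.image_singleton, Ideal.mem_span_singleton] at h1
  obtain ⟨f, hf⟩ := h1
  exact ⟨f, by rw [← hf]; ring⟩

section

variable {W : Type u} [CommRing W] [IsDomain W] [IsDiscreteValuationRing W] [CharZero W]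
  {K : Type u} [Field K] [Algebra W K]
  [Algebra (FractionRing W) K] [IsScalarTower W (FractionRing W) K]
  [FiniteDimensional (FractionRing W) K]

theorem finite_OK : Module.Finite W (OK W K) := by
  have : CharZero (FractionRing W) :=
    charZero_of_injective_algebraMap (IsFractionRing.injective W (FractionRing W))
  exact IsIntegralClosure.finite W (FractionRing W) K (OK W K)

/-- `W` is dense in `O_K / (π)`, so by Nakayama `O_K = W[π]` once `π ^ e` is divisible by `ϖ`. -/
theorem aeval_surjective_of_isTotRamified (hK : IsTotRamified W K) {π : OK W K}
    (hπ : IsUniformizer W K π) {ϖ : W} (hϖ : ϖ ∈ maximalIdeal W) {e : ℕ}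
    (he : algebraMap W (OK W K) ϖ ∣ π ^ e) : Function.Surjective (aeval (R := W) π) := by
  have := finite_OK (W := W) (K := K)
  have hres : ∀ y : OK W K, ∃ w z, y = algebraMap W _ w + π * z := by
    intro y
    obtain ⟨w, hw⟩ := hK _ hπ (Ideal.Quotient.mk (Ideal.span {π}) y)
    have h1 : y - algebraMap W _ w ∈ Ideal.span {π} :=
      (Ideal.Quotient.mk_eq_mk_iff_sub_mem _ _).1 hw.symm
    obtain ⟨z, hz⟩ := Ideal.mem_span_singleton.1 h1
    exact ⟨w, z, by rw [← hz]; ring⟩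
  have happrox : ∀ j, ∀ y : OK W K, ∃ (g : W[X]) (z : OK W K), y = aeval π g + π ^ j * z := by
    intro j y
    induction j with
    | zero => exact ⟨0, y, by simp⟩
    | succ j ih =>
      obtain ⟨g, z, hy⟩ := ih
      obtain ⟨w, z', hz⟩ := hres z
      refine ⟨g + X ^ j * C w, z', ?_⟩
      rw [hy, hz, map_add, map_mul, map_pow, aeval_X, aeval_C]
      ring
  have htop : (⊤ : Submodule W (OK W K)) ≤ LinearMap.range (aeval (R := W) π).toLinearMap := by
    refine Submodule.le_of_le_smul_of_le_jacobson_bot Module.Finite.fg_top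
      (IsLocalRing.maximalIdeal_le_jacobson ⊥) fun y _ => ?_
    obtain ⟨g, z, hy⟩ := happrox e y
    obtain ⟨c, hc⟩ := he
    rw [hy, hc, mul_assoc, ← Algebra.smul_def]
    exact add_mem (Submodule.mem_sup_left ⟨g, rfl⟩)
      (Submodule.mem_sup_right (Submodule.smul_mem_smul hϖ Submodule.mem_top))
  intro y
  exact htop (Submodule.mem_top (x := y))

/-- The minimal polynomial of a uniformizer of a totally ramified extension is an Eisenstein
polynomial. -/
theorem exists_minpoly_eq [IsAdicComplete (maximalIdeal W) W] (hK : IsTotRamified W K) {π : OK W K}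
    (hπ : IsUniformizer W K π) {ϖ : W} (hϖ : maximalIdeal W = Ideal.span {ϖ}) :
    ∃ f : W[X], minpoly W π = X ^ (minpoly W π).natDegree + C ϖ * f ∧ IsUnit (f.coeff 0) ∧
      0 < (minpoly W π).natDegree := by
  have hinj : Function.Injective (algebraMap W K) := by
    rw [IsScalarTower.algebraMap_eq W (FractionRing W) K]
    exact (algebraMap (FractionRing W) K).injective.comp (IsFractionRing.injective _ _)
  have hinj' : Function.Injective (algebraMap W (OK W K)) := fun x y hxy =>
    hinj (congrArg (algebraMap (OK W K) K) hxy)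
  have : Module.IsTorsionFree W (OK W K) := Module.isTorsionFree_iff_algebraMap_injective.2 hinj'
  have hint : IsIntegral W π := integralClosure.isIntegral π
  have hpos := minpoly.natDegree_pos hint
  have hϖ0 : ϖ ≠ 0 := by
    rintro rfl
    exact IsDiscreteValuationRing.not_a_field W (by rw [hϖ]; simp)
  -- the constant coefficient of `E` is a multiple of `π`
  have h0 : (minpoly W π).coeff 0 ∈ maximalIdeal W := by
    intro hu
    have h1 := minpoly.aeval W π
    rw [← divX_mul_X_add (minpoly W π), map_add, map_mul, aeval_X, aeval_C] at h1
    refine hπ.ne_top ((Ideal.span_singleton_eq_top).2 ?_)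
    refine isUnit_of_dvd_unit ?_ (hu.map (algebraMap W (OK W K)))
    exact ⟨-aeval π (divX (minpoly W π)), by linear_combination h1⟩
  have hdist := isDistinguishedAt_of_irreducible (minpoly.monic hint)
    (minpoly.prime_of_isIntegrallyClosed hint).irreducible h0
  rw [hϖ] at hdist
  obtain ⟨f, hf⟩ := exists_eq_X_pow_add_C_mul hdist
  refine ⟨f, hf, ?_, hpos⟩
  have hsurj := aeval_surjective_of_isTotRamified hK hπ
    (hϖ ▸ Ideal.mem_span_singleton_self ϖ) (e := (minpoly W π).natDegree) (by
      have h1 := minpoly.aeval W π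
      rw [hf, map_add, map_mul, map_pow, aeval_X, aeval_C] at h1
      exact ⟨-aeval π f, by linear_combination h1⟩)
  -- `ϖ` is a multiple of `π` in `W[π]`, so the constant coefficient of `E` divides `ϖ`
  have hmax : (Ideal.span {π}).IsMaximal := hπ
  have hcomap := IsLocalRing.eq_maximalIdeal
    (Ideal.isMaximal_comap_of_isIntegral_of_isMaximal (R := W) (Ideal.span {π}))
  have h2 : ϖ ∈ (Ideal.span {π}).comap (algebraMap W (OK W K)) := by
    rw [hcomap, hϖ]
    exact Ideal.mem_span_singleton_self ϖ
  obtain ⟨y, hy⟩ := Ideal.mem_span_singleton.1 (Ideal.mem_comap.1 h2)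
  obtain ⟨g, rfl⟩ := hsurj y
  obtain ⟨c, hc⟩ := minpoly.isIntegrallyClosed_dvd hint (p := X * g - C ϖ) (by
    rw [map_sub, map_mul, aeval_X, aeval_C, hy, sub_self])
  have h3 := congrArg (fun q => q.coeff 0) hc
  rw [hf] at h3
  simp only [coeff_sub, mul_coeff_zero, coeff_X_zero, zero_mul, coeff_C_zero, zero_sub, coeff_add,
    coeff_X_pow, if_neg hpos.ne, zero_add] at h3
  refine IsUnit.of_mul_eq_one (-c.coeff 0) (mul_left_cancel₀ hϖ0 ?_)
  linear_combination h3

end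

end RelBK

/-! ### Modules of finite height -/

namespace RelBK

open PowerSeries

/-- Over a base ring, a power of `p` factors through finite free modules as an endomorphism of a
module of finite height. -/
theorem HeightLE.exists_natCast_pow_mem_freeFactorIdeal {p : ℕ} [hp : Fact p.Prime] {R : Type u}
    [CommRing R] [IsDomain R] (hR : IsGood p R) (hp0 : (p : R) ≠ 0) {φ : R →+* R}
    (hφ : ∀ x, φ x - x ^ p ∈ Ideal.span {(p : R)}) {M : Type v} [AddCommGroup M] [Module R⟦X⟧ M]
    [Module.Finite R⟦X⟧ M] {φM : M →ₛₗ[frobS p φ] M} {E w : R⟦X⟧} {e r : ℕ} (he : 0 < e)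
    (hw : IsUnit w) (hE : E = X ^ e + (p : R⟦X⟧) * w) (h : HeightLE E r φM) :
    ∃ n, (p : R⟦X⟧) ^ n ∈ freeFactorIdeal R⟦X⟧ M := by
  have := hR.noeth
  have := hR.complete
  have hφf := hR.flat_frobenius hp0 hφ
  have hfl := flat_frobS (p := p) hφf
  have hjac : (p : R) ∈ Ideal.jacobson (⊥ : Ideal R) :=
    IsAdicComplete.le_jacobson_bot _ (Ideal.mem_span_singleton_self (p : R))
  let P := freeFactorIdeal R⟦X⟧ M
  obtain ⟨m, k, hk⟩ := exists_natCast_pow_mem (I := saturation P (p : R⟦X⟧)) (n := r) hφf hφ hp0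
    (hR.isDomain_quotient hp.out) hjac
    (fun hb => freeFactorIdeal_ne_bot M (le_bot_iff.1 (hb ▸ le_saturation P _)))
    (fun x => mem_saturation_of_mul_mem) he hw hE
    (fun x hx => mul_mem_map_saturation hfl (fun y hy => (h.freeFactorIdeal_mul hfl).1 hy) hx)
    (fun x hx => by
      obtain ⟨k, hk⟩ := hx
      refine ⟨k, ?_⟩
      have := (h.freeFactorIdeal_mul hfl).2 hk
      rwa [map_mul, map_pow, map_natCast, mul_left_comm] at this)
  exact ⟨k + m, by rwa [pow_add]⟩

section

variable (p : ℕ) [hp : Fact p.Prime] (k : Type u) [Field k] [CharP k p]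

theorem charZero_wittVector : CharZero (WittVector p k) := by
  have h := CharP.exists (WittVector p k)
  obtain ⟨q, hq⟩ := h
  have h1 : (q : k) = 0 := by
    rw [← map_natCast (WittVector.constantCoeff (p := p) (R := k)), CharP.cast_eq_zero, map_zero]
  have h2 : p ∣ q := (CharP.cast_eq_zero_iff k p q).1 h1
  rcases CharP.char_is_prime_or_zero (WittVector p k) q with hq' | rfl
  · obtain rfl := (Nat.prime_dvd_prime_iff_eq hp.out hq').1 h2
    exact absurd (CharP.cast_eq_zero (WittVector p k) p) (WittVector.p_nonzero p k)
  · exact CharP.charP_to_charZero _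

theorem maximalIdeal_wittVector [PerfectRing k p] :
    IsLocalRing.maximalIdeal (WittVector p k) = Ideal.span {(p : WittVector p k)} := by
  refine (IsLocalRing.eq_maximalIdeal ?_).symm
  exact Ideal.Quotient.maximal_of_isField _
    (WittVector.quotientPEquiv.toMulEquiv.isField (Field.toIsField k))

end

/-- `E` has the form `u ^ e + p w` with a unit `w`. -/
theorem exists_eisE_eq {p : ℕ} [Fact p.Prime] {k : Type u} [Field k] [CharP k p] [PerfectRing k p]
    {K : Type u} [Field K] [Algebra (WittVector p k) K] [Algebra (FractionRing (WittVector p k)) K]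
    [IsScalarTower (WittVector p k) (FractionRing (WittVector p k)) K]
    [FiniteDimensional (FractionRing (WittVector p k)) K]
    (hK : IsTotRamified (WittVector p k) K) {π : OK (WittVector p k) K}
    (hπ : IsUniformizer (WittVector p k) K π) (R : Type u) [CommRing R]
    [Algebra (WittVector p k) R] :
    ∃ (e : ℕ) (w : R⟦X⟧), 0 < e ∧ IsUnit w ∧
      eisE (WittVector p k) K π R = X ^ e + (p : R⟦X⟧) * w := by
  have := charZero_wittVector p k
  have hmax := maximalIdeal_wittVector p k
  have : IsAdicComplete (IsLocalRing.maximalIdeal (WittVector p k)) (WittVector p k) := by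
    rw [hmax]; infer_instance
  obtain ⟨f, hf, hu, hpos⟩ := exists_minpoly_eq hK hπ hmax
  refine ⟨_, ((f.map (algebraMap (WittVector p k) R) : Polynomial R) : R⟦X⟧), hpos, ?_, ?_⟩
  · rw [isUnit_iff_constantCoeff, Polynomial.constantCoeff_coe, Polynomial.coeff_map]
    exact hu.map _
  · rw [eisE]
    conv_lhs => rw [hf]
    rw [Polynomial.map_add, Polynomial.map_mul, Polynomial.map_C, map_natCast, Polynomial.map_pow,
      Polynomial.map_X, Polynomial.coe_add, Polynomial.coe_mul, Polynomial.coe_pow,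
      Polynomial.coe_X, Polynomial.coe_C, map_natCast]

end RelBK

theorem proposition4p12 (p : ℕ) [Fact p.Prime]
    (k : Type u) [Field k] [CharP k p] [PerfectRing k p]
    (K : Type u) [Field K] [Algebra (WittVector p k) K]
    [Algebra (FractionRing (WittVector p k)) K]
    [IsScalarTower (WittVector p k) (FractionRing (WittVector p k)) K]
    [FiniteDimensional (FractionRing (WittVector p k)) K]
    (hK : RelBK.IsTotRamified (WittVector p k) K)
    (π : RelBK.OK (WittVector p k) K) (hπ : RelBK.IsUniformizer (WittVector p k) K π)
    (d : ℕ) (R₀ : Type u) [CommRing R₀] [Algebra (WittVector p k) R₀]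
    [Algebra (RelBK.CLaurent p d (WittVector p k)) R₀]
    [IsScalarTower (WittVector p k) (RelBK.CLaurent p d (WittVector p k)) R₀]
    (hR₀ : RelBK.IsBase p d (WittVector p k) R₀)
    (hR : RelBK.IsSmall p (RelBK.OK (WittVector p k) K)
        (TensorProduct (WittVector p k) (RelBK.OK (WittVector p k) K) R₀) ∨
      RelBK.IsOL₀ p d (WittVector p k) R₀)
    (φ : R₀ →+* R₀) (hφ : RelBK.IsFrobenius p d (WittVector p k) R₀ φ)
    (M : Type v) [AddCommGroup M] [Module (PowerSeries R₀) M]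
    [Module.Finite (PowerSeries R₀) M]
    (φM : M →ₛₗ[RelBK.frobS p φ] M)
    (hM : RelBK.FiniteHeight (RelBK.eisE (WittVector p k) K π R₀) φM) :
    Module.Projective (Localization.Away (p : PowerSeries R₀))
      (LocalizedModule (Submonoid.powers (p : PowerSeries R₀)) M) := by
  have := hR₀.isDomain
  suffices h : ∃ n, (p : PowerSeries R₀) ^ n ∈ RelBK.freeFactorIdeal (PowerSeries R₀) M by
    obtain ⟨n, hn⟩ := h
    exact RelBK.projective_of_pow_mem_freeFactorIdeal hn
  by_cases hp0 : (p : R₀) = 0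
  · refine ⟨1, ?_⟩
    rw [pow_one, ← map_natCast PowerSeries.C, hp0, map_zero]
    exact zero_mem _
  · obtain ⟨r, hr⟩ := hM
    obtain ⟨e, w, he, hw, hE⟩ := RelBK.exists_eisE_eq hK hπ R₀
    exact hr.exists_natCast_pow_mem_freeFactorIdeal
      (RelBK.isGood_of_isIterated hR₀.isIterated) hp0 hφ.lift he hw hE
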